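/- Let $M$ be a (connected) Riemann surface with complex structure $J$ on $TM$, and for a smooth map $g$ from $M$ to a real vector space write $*dg=dg\circ J$. Identify $\mathbb R^4$ with the quaternions $\mathbb H$. Let $f:M\to\mathbb H$ be a smooth conformal immersion, i.e. an immersion for which there are $N,R:M\to\mathbb H$ (then unique, called the left and right normal vector of $f$) with $N^2=-1=R^2$ and $*df=N\,df=-df\,R$. Let $II(X,Y)=(X\cdot df(Y))^{\perp}$ be its second fundamental form. Call $f$ super-conformal if at every $p\in M$ the curvature ellipse $\{II(X,X): X\in T_pM,\ |df(X)|=1\}$ is a circle in the normal plane $df(T_pM)^\perp$, a single point (at umbilic points) being regarded as a circle of radius $0$. Regard $\mathbb H^2$ as a right quaternionic vector space, let $\mathbb HP^1$ be the set of its quaternionic lines, and identify $\mathbb H^2=\mathbb C^4$, where $i$ acts by right multiplication. A holomorphic curve in $\mathbb CP^3$ is a smooth complex line subbundle $E\subset M\times\mathbb C^4$ such that $*\delta_E=\delta_E J_E$, where $J_E$ is multiplication by $i$ on $E$ and $\delta_E(X)\varphi=d\varphi(X)\bmod E$ for smooth local sections $\varphi$ of $E$. A map $g:M\to\mathbb HP^1$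 is the twistor projection of $E$ if $g(p)=E_p\mathbb H$ for all $p\in M$. Then the following are equivalent: (i) $f$ is super-conformal; (ii) $\begin{bmatrix} f\\1\end{bmatrix}:M\to\mathbb HP^1$ or $\begin{bmatrix}\bar f\\1\end{bmatrix}:M\to\mathbb HP^1$ is the twistor projection of a holomorphic curve in $\mathbb CP^3$; (iii) the right normal vector $R$ of $f$, or the right normal vector $R$ of $\bar f$, satisfies $*dR=R\,dR$ on all of $M$. -/

import Mathlib

open scoped Manifold ContDiff Quaternion

namespace SuperConformal

noncomputable section

/-! Throughout, `M` is a Riemann surface: a charted space over `ℂ` with holomorphic transition maps.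
Its tangent space at `p` is, by definition in Mathlib, a copy of `ℂ` (through the preferred chart
at `p`); as the transition maps are holomorphic, multiplication by `Complex.I` on this copy
is the complex structure `J : T_pM → T_pM`.  Real smoothness is smoothness with respect to the
real model `𝓘(ℝ, ℂ)`. -/

section Surface

variable {M : Type*} [TopologicalSpace M] [ChartedSpace ℂ M]

/-- The real differential `d_p g : T_pM → F` of a map from the surface to a real normed space. -/
def diff {F : Type*} [NormedAddCommGroup F] [NormedSpace ℝ F] (g : M → F) (p : M) : ℂ →L[ℝ] F :=
  mfderiv 𝓘(ℝ, ℂ) 𝓘(ℝ, F) g p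

/-- The form `*dg = dg ∘ J`. -/
def starDiff {F : Type*} [NormedAddCommGroup F] [NormedSpace ℝ F] (g : M → F) (p : M) (X : ℂ) : F :=
  diff g p (Complex.I * X)

/-- `N` is a left normal vector of `f`: `N² = -1` and `*df = N df`. -/
def IsLeftNormal (f N : M → ℍ[ℝ]) : Prop :=
  (∀ p, N p * N p = -1) ∧ ∀ p X, starDiff f p X = N p * diff f p X

/-- `R` is a right normal vector of `f`: `R² = -1` and `*df = -df R`. -/
def IsRightNormal (f R : M → ℍ[ℝ]) : Prop :=
  (∀ p, R p * R p = -1) ∧ ∀ p X, starDiff f p X = -(diff f p X * R p)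

/-- A smooth conformal immersion of the surface into `ℍ = ℝ⁴`. -/
structure IsConformalImmersion (f : M → ℍ[ℝ]) : Prop where
  smooth : ContMDiff 𝓘(ℝ, ℂ) 𝓘(ℝ, ℍ[ℝ]) ∞ f
  immersion : ∀ p, Function.Injective (diff f p)
  conformal : ∃ N R : M → ℍ[ℝ], IsLeftNormal f N ∧ IsRightNormal f R

/-- The Euclidean normal space of `f` at `p`, the orthogonal complement of `df(T_pM)`. -/
def normalSpace (f : M → ℍ[ℝ]) (p : M) : Submodule ℝ ℍ[ℝ] :=
  (LinearMap.range (diff f p).toLinearMap)ᗮ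

/-- The second fundamental form `II(X, Y) = (X · df(Y))^⊥` at `p`, where `Y` is extended to the
vector field with constant coefficients in the preferred chart at `p` (the normal part does not
depend on the extension). -/
def secondFundamentalForm (f : M → ℍ[ℝ]) (p : M) (X Y : ℂ) : ℍ[ℝ] :=
  (normalSpace f p).starProjection
    (fderiv ℝ (fun z => fderiv ℝ (f ∘ (chartAt ℂ p).symm) z Y) (chartAt ℂ p p) X)

/-- The curvature ellipse at `p`: the image of the unit tangential circle under the quadratic
second fundamental form. -/
def curvatureEllipse (f : M → ℍ[ℝ]) (p : M) : Set ℍ[ℝ] :=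
  {v | ∃ X : ℂ, ‖diff f p X‖ = 1 ∧ v = secondFundamentalForm f p X X}

/-- `f` is super-conformal: at every point the curvature ellipse is a circle in the normal plane.
The radius may be `0` (umbilic points). -/
def IsSuperConformal (f : M → ℍ[ℝ]) : Prop :=
  ∀ p, ∃ c ∈ normalSpace f p, ∃ r : ℝ, 0 ≤ r ∧
    curvatureEllipse f p = {v | v ∈ normalSpace f p ∧ ‖v - c‖ = r}

/-- `*dR = R dR` for the right normal vector `R` of `f`. -/
def RightNormalHolomorphic (f : M → ℍ[ℝ]) : Prop :=
  ∃ R : M → ℍ[ℝ], IsRightNormal f R ∧ ∀ p X, starDiff R p X = R p * diff R p X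

end Surface

/-- Complex projective space `ℂP³`. -/
abbrev CP3 := Projectivization ℂ (Fin 4 → ℂ)

/-- The quaternionic projective line: lines in the *right* `ℍ`-vector space `ℍ²`
(right multiplication by `ℍ` is the module structure over the opposite ring). -/
abbrev HP1 := Projectivization (ℍ[ℝ])ᵐᵒᵖ (ℍ[ℝ] × ℍ[ℝ])

/-- The unit `j`. -/
def quatJ : ℍ[ℝ] := ⟨0, 0, 1, 0⟩

/-- The identification `ℂ⁴ = ℍ²`, `(z₀, z₁, z₂, z₃) ↦ (z₀ + j z₁, z₂ + j z₃)`. -/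
def toH2 (z : Fin 4 → ℂ) : ℍ[ℝ] × ℍ[ℝ] :=
  ((z 0 : ℍ[ℝ]) + quatJ * (z 1 : ℍ[ℝ]), (z 2 : ℍ[ℝ]) + quatJ * (z 3 : ℍ[ℝ]))

/-- Under `ℂ⁴ = ℍ²` the complex scalars act by right multiplication. -/
theorem toH2_smul (c : ℂ) (z : Fin 4 → ℂ) :
    toH2 (c • z) = MulOpposite.op (c : ℍ[ℝ]) • toH2 z := by
  simp only [toH2, Pi.smul_apply, smul_eq_mul, Prod.smul_mk, MulOpposite.smul_eq_mul_unop,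
    MulOpposite.unop_op, Quaternion.coeComplex_mul, add_mul, mul_assoc]
  simp only [← Quaternion.coeComplex_mul, mul_comm c]

/-- The affine point `[x; 1]` of `ℍP¹`. -/
def affinePoint (x : ℍ[ℝ]) : HP1 :=
  Projectivization.mk (ℍ[ℝ])ᵐᵒᵖ (x, 1) (fun h => one_ne_zero (congrArg Prod.snd h))

section Twistor

variable {M : Type*} [TopologicalSpace M] [ChartedSpace ℂ M]

/-- `φ` is a smooth section over `U` of the family of complex lines `E ⊂ M × ℂ⁴`. -/
def IsSection (E : M → CP3) (U : Set M) (φ : M → Fin 4 → ℂ) : Prop :=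
  ContMDiffOn 𝓘(ℝ, ℂ) 𝓘(ℝ, Fin 4 → ℂ) ∞ φ U ∧ ∀ q ∈ U, φ q ∈ (E q).submodule

/-- `E` is a smooth complex line subbundle of `M × ℂ⁴`: it has smooth local frames. -/
def IsLineSubbundle (E : M → CP3) : Prop :=
  ∀ p, ∃ U : Set M, IsOpen U ∧ p ∈ U ∧ ∃ φ, IsSection E U φ ∧ ∀ q ∈ U, φ q ≠ 0

/-- `δ_E(X) φ = π_E (dφ(X))`, with values in `ℂ⁴ / E_p`. -/
def delta (E : M → CP3) (φ : M → Fin 4 → ℂ) (p : M) (X : ℂ) :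
    (Fin 4 → ℂ) ⧸ (E p).submodule :=
  (E p).submodule.mkQ (diff φ p X)

/-- `E` is a holomorphic curve in `ℂP³`: a smooth complex line subbundle of `M × ℂ⁴` such that
`*δ_E = δ_E J_E`, where `J_E` is multiplication by `i`. -/
def IsHolomorphicCurve (E : M → CP3) : Prop :=
  IsLineSubbundle E ∧
    ∀ (U : Set M) (φ : M → Fin 4 → ℂ), IsOpen U → IsSection E U φ →
      ∀ p ∈ U, ∀ X : ℂ,
        delta E φ p (Complex.I * X) = delta E (fun q => Complex.I • φ q) p X

/-- `g : M → ℍP¹` is the twistor projection of `E`: the quaternionic line `g(p)` is `E_p ℍ`. -/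
def IsTwistorProjection (E : M → CP3) (g : M → HP1) : Prop :=
  ∀ p, (g p).submodule = Submodule.span (ℍ[ℝ])ᵐᵒᵖ (toH2 '' ((E p).submodule : Set (Fin 4 → ℂ)))

/-- `g : M → ℍP¹` is the twistor projection of a holomorphic curve in `ℂP³`. -/
def IsTwistorHolomorphic (g : M → HP1) : Prop :=
  ∃ E : M → CP3, IsHolomorphicCurve E ∧ IsTwistorProjection E g

end Twistor

end

end SuperConformal

/-!
For a conformal immersion with left and right normal vectors `N` and `R`, the curvature ellipse at
a point is the image of a circle under a real linear map, and it is a circle precisely when that map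
is conformal. On the normal plane left multiplication by `N` is a complex structure, equal up to
sign to right multiplication by `R`, and the two orientations of the ellipse correspond to the two
equations `*dN = N dN` and `*dR = R dR` at that point. As `N` is up to sign the right normal vector
of the conjugate immersion, it remains to see that the same equation can be taken at all points.

If a complex line subbundle `E` has `[f; 1]` as its twistor projection, then `E` consists of vectors
`(f l, l)`. Holomorphicity of `E` forces `R l = -l i`, which determines `E` from `R`, and this `E`
is holomorphic exactly when `*dR = R dR`. In local coordinates it is the curve `[1 : r : a₁ : a₂]`,
where `r` is the stereographic coordinate of `R`.

The equation for `R` is `∂̄r = 0`, and the equation for `N` is the vanishing of the minor of the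
first two derivatives of `f`, regarded as a pair of complex functions. The minor of `f` vanishes on
an open set only if the minors of the curve `(1, r, a₁, a₂)` do, and these are holomorphic where
`∂̄r = 0`. If at every point of a disc one of the two equations holds, the minors of the curve are
therefore holomorphic on all of the disc, so that they vanish identically as soon as the equation
for `N` holds on a nonempty open subset. Connectedness of the surface spreads this conclusion to
every point.
-/

namespace SuperConformal

noncomputable section

open Complex Metric
open scoped ComplexConjugate Topology RealInnerProductSpace

/-! ### Wirtinger derivatives -/

section Wirtinger

/-- The Wirtinger derivative `∂g = (g_x - i g_y) / 2`. -/
def del (g : ℂ → ℂ) (z : ℂ) : ℂ := 2⁻¹ * (fderiv ℝ g z 1 - I * fderiv ℝ g z I)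

/-- The Wirtinger derivative `∂̄g = (g_x + i g_y) / 2`. -/
def delbar (g : ℂ → ℂ) (z : ℂ) : ℂ := 2⁻¹ * (fderiv ℝ g z 1 + I * fderiv ℝ g z I)

/-- The real differential of `g` at `z` is `X ↦ a X + b X̄`, that is `∂g = a` and `∂̄g = b`; the
calculus of both Wirtinger derivatives is developed at once in this form. -/
def HasWirtingerDerivAt (g : ℂ → ℂ) (a b z : ℂ) : Prop :=
  HasFDerivAt g (a • ContinuousLinearMap.id ℝ ℂ + b • (conjCLE : ℂ →L[ℝ] ℂ)) z

variable {g h : ℂ → ℂ} {a b c d z : ℂ} {Ω : Set ℂ}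

theorem hasWirtingerDerivAt (hg : DifferentiableAt ℝ g z) :
    HasWirtingerDerivAt g (del g z) (delbar g z) z := by
  refine hg.hasFDerivAt.congr_fderiv (ContinuousLinearMap.ext fun X => ?_)
  have hX : fderiv ℝ g z X = X.re • fderiv ℝ g z 1 + X.im • fderiv ℝ g z I := by
    rw [← map_smul, ← map_smul, ← map_add]
    congr 1
    simp
  simp only [hX, del, delbar, add_apply, smul_apply,
    ContinuousLinearMap.id_apply, ContinuousLinearEquiv.coe_coe, conjCLE_apply, smul_eq_mul,
    real_smul]
  nth_rw 3 4 [← re_add_im X]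
  rw [map_add, map_mul, conj_ofReal, conj_ofReal, conj_I]
  linear_combination ((X.im : ℂ) * fderiv ℝ g z I) * I_sq

namespace HasWirtingerDerivAt

theorem del_eq (hg : HasWirtingerDerivAt g a b z) : del g z = a := by
  simp only [del, hg.fderiv, add_apply, smul_apply,
    ContinuousLinearMap.id_apply, ContinuousLinearEquiv.coe_coe, conjCLE_apply, smul_eq_mul,
    map_one, conj_I]
  linear_combination (b - a) / 2 * I_sq

theorem delbar_eq (hg : HasWirtingerDerivAt g a b z) : delbar g z = b := by
  simp only [delbar, hg.fderiv, add_apply, smul_apply,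
    ContinuousLinearMap.id_apply, ContinuousLinearEquiv.coe_coe, conjCLE_apply, smul_eq_mul,
    map_one, conj_I]
  linear_combination (a - b) / 2 * I_sq

protected theorem add (hg : HasWirtingerDerivAt g a b z) (hh : HasWirtingerDerivAt h c d z) :
    HasWirtingerDerivAt (fun z => g z + h z) (a + c) (b + d) z :=
  (HasFDerivAt.fun_add hg hh).congr_fderiv (by ext X; simp; ring)

protected theorem sub (hg : HasWirtingerDerivAt g a b z) (hh : HasWirtingerDerivAt h c d z) :
    HasWirtingerDerivAt (fun z => g z - h z) (a - c) (b - d) z :=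
  (HasFDerivAt.fun_sub hg hh).congr_fderiv (by ext X; simp; ring)

protected theorem neg (hg : HasWirtingerDerivAt g a b z) :
    HasWirtingerDerivAt (fun z => -g z) (-a) (-b) z :=
  (HasFDerivAt.fun_neg hg).congr_fderiv (by ext X; simp; ring)

protected theorem mul (hg : HasWirtingerDerivAt g a b z) (hh : HasWirtingerDerivAt h c d z) :
    HasWirtingerDerivAt (fun z => g z * h z) (a * h z + g z * c) (b * h z + g z * d) z :=
  (HasFDerivAt.mul hg hh).congr_fderiv (by ext X; simp; ring)

theorem conj_comp (hg : HasWirtingerDerivAt g a b z) :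
    HasWirtingerDerivAt (fun z => conj (g z)) (conj b) (conj a) z :=
  ((conjCLE : ℂ →L[ℝ] ℂ).hasFDerivAt.comp z hg).congr_fderiv (by ext X; simp; ring)

end HasWirtingerDerivAt

theorem del_congr (e : g =ᶠ[𝓝 z] h) : del g z = del h z := by
  rw [del, del, e.fderiv_eq]

theorem delbar_congr (e : g =ᶠ[𝓝 z] h) : delbar g z = delbar h z := by
  rw [delbar, delbar, e.fderiv_eq]

theorem del_zero (z : ℂ) : del (fun _ => 0) z = 0 := by simp [del]

theorem delbar_const (c z : ℂ) : delbar (fun _ => c) z = 0 := by simp [delbar]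

theorem del_neg (g : ℂ → ℂ) : del (-g) = -del g := by
  ext z
  simp only [del, fderiv_neg, neg_apply, Pi.neg_apply]
  ring

theorem delbar_neg (g : ℂ → ℂ) : delbar (-g) = -delbar g := by
  ext z
  simp only [delbar, fderiv_neg, neg_apply, Pi.neg_apply]
  ring

theorem differentiableAt_iff_delbar_eq_zero :
    DifferentiableAt ℂ g z ↔ DifferentiableAt ℝ g z ∧ delbar g z = 0 := by
  rw [differentiableAt_complex_iff_differentiableAt_real, smul_eq_mul]
  refine and_congr_right fun _ => ⟨fun e => ?_, fun e => ?_⟩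
  · rw [delbar, e]
    linear_combination fderiv ℝ g z 1 / 2 * I_sq
  · rw [delbar] at e
    linear_combination (-2 * I) * e + fderiv ℝ g z I * I_sq

theorem contDiffOn_fderiv_apply {F : Type*} [NormedAddCommGroup F] [NormedSpace ℝ F] {g : ℂ → F}
    (hΩ : IsOpen Ω) (hg : ContDiffOn ℝ ∞ g Ω) (X : ℂ) :
    ContDiffOn ℝ ∞ (fun z => fderiv ℝ g z X) Ω :=
  (hg.fderiv_of_isOpen hΩ (by simp)).clm_apply contDiffOn_const

theorem differentiableAt_of_contDiffOn {F : Type*} [NormedAddCommGroup F] [NormedSpace ℝ F]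
    {g : ℂ → F} (hΩ : IsOpen Ω) (hg : ContDiffOn ℝ ∞ g Ω) (hz : z ∈ Ω) :
    DifferentiableAt ℝ g z :=
  (hg.contDiffAt (hΩ.mem_nhds hz)).differentiableAt (by simp)

theorem contDiffOn_del (hΩ : IsOpen Ω) (hg : ContDiffOn ℝ ∞ g Ω) : ContDiffOn ℝ ∞ (del g) Ω :=
  contDiffOn_const.mul ((contDiffOn_fderiv_apply hΩ hg 1).sub
    (contDiffOn_const.mul (contDiffOn_fderiv_apply hΩ hg I)))

theorem contDiffOn_delbar (hΩ : IsOpen Ω) (hg : ContDiffOn ℝ ∞ g Ω) :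
    ContDiffOn ℝ ∞ (delbar g) Ω :=
  contDiffOn_const.mul ((contDiffOn_fderiv_apply hΩ hg 1).add
    (contDiffOn_const.mul (contDiffOn_fderiv_apply hΩ hg I)))

theorem fderiv_fderiv_apply {F : Type*} [NormedAddCommGroup F] [NormedSpace ℝ F] {g : ℂ → F}
    (hΩ : IsOpen Ω) (hg : ContDiffOn ℝ ∞ g Ω) (hz : z ∈ Ω) (X Y : ℂ) :
    fderiv ℝ (fun z => fderiv ℝ g z Y) z X = fderiv ℝ (fderiv ℝ g) z X Y := by
  have h := differentiableAt_of_contDiffOn hΩ (hg.fderiv_of_isOpen (m := ∞) hΩ (by simp)) hz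
  rw [fderiv_clm_apply h (differentiableAt_const Y)]
  simp

theorem fderiv_fderiv_apply_comm {F : Type*} [NormedAddCommGroup F] [NormedSpace ℝ F] {g : ℂ → F}
    (hΩ : IsOpen Ω) (hg : ContDiffOn ℝ ∞ g Ω) (hz : z ∈ Ω) (X Y : ℂ) :
    fderiv ℝ (fun z => fderiv ℝ g z Y) z X = fderiv ℝ (fun z => fderiv ℝ g z X) z Y := by
  have h : IsSymmSndFDerivAt ℝ g z :=
    (hg.contDiffAt (hΩ.mem_nhds hz)).isSymmSndFDerivAt
      (by simp [minSmoothness_of_isRCLikeNormedField, ENat.LEInfty.out])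
  rw [fderiv_fderiv_apply hΩ hg hz, fderiv_fderiv_apply hΩ hg hz, h.eq]

theorem delbar_del (hΩ : IsOpen Ω) (hg : ContDiffOn ℝ ∞ g Ω) (hz : z ∈ Ω) :
    delbar (del g) z = del (delbar g) z := by
  have h (X : ℂ) := (differentiableAt_of_contDiffOn hΩ
    (contDiffOn_fderiv_apply hΩ hg X) hz).hasFDerivAt
  have hdel : HasFDerivAt (del g) _ z := ((h 1).sub ((h I).const_mul I)).const_mul 2⁻¹
  have hdelbar : HasFDerivAt (delbar g) _ z := ((h 1).add ((h I).const_mul I)).const_mul 2⁻¹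
  simp only [del.eq_1 (delbar g), delbar.eq_1 (del g), hdel.fderiv, hdelbar.fderiv, smul_apply,
    sub_apply, add_apply, smul_eq_mul, fderiv_fderiv_apply_comm hΩ hg hz I 1]
  ring

end Wirtinger

/-! ### The osculating minors of the twistor lift -/

section Minors

/-- The minor `∂g ∂²h - ∂²g ∂h` of the first two derivatives of a curve with coordinates `g` and
`h`. For a holomorphic curve it is holomorphic, so that the identity theorem applies to it. -/
def osculatingMinor (g h : ℂ → ℂ) (z : ℂ) : ℂ :=
  del g z * del (del h) z - del (del g) z * del h z

variable {g h : ℂ → ℂ} {z : ℂ} {Ω : Set ℂ}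

theorem contDiffOn_osculatingMinor (hΩ : IsOpen Ω) (hg : ContDiffOn ℝ ∞ g Ω)
    (hh : ContDiffOn ℝ ∞ h Ω) : ContDiffOn ℝ ∞ (osculatingMinor g h) Ω :=
  ((contDiffOn_del hΩ hg).mul (contDiffOn_del hΩ (contDiffOn_del hΩ hh))).sub
    ((contDiffOn_del hΩ (contDiffOn_del hΩ hg)).mul (contDiffOn_del hΩ hh))

theorem hasWirtingerDerivAt_of_mem (hΩ : IsOpen Ω) (hg : ContDiffOn ℝ ∞ g Ω) (hz : z ∈ Ω) :
    HasWirtingerDerivAt g (del g z) (delbar g z) z :=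
  hasWirtingerDerivAt (differentiableAt_of_contDiffOn hΩ hg hz)

theorem delbar_del_eq_zero (hΩ : IsOpen Ω) (hg : ContDiffOn ℝ ∞ g Ω) (hz : z ∈ Ω)
    (h0 : delbar g =ᶠ[𝓝 z] 0) : delbar (del g) z = 0 := by
  rw [delbar_del hΩ hg hz, del_congr h0]
  exact del_zero z

theorem delbar_osculatingMinor_eq_zero (hΩ : IsOpen Ω) (hg : ContDiffOn ℝ ∞ g Ω)
    (hh : ContDiffOn ℝ ∞ h Ω) (hz : z ∈ Ω) (hg0 : delbar g =ᶠ[𝓝 z] 0)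
    (hh0 : delbar h =ᶠ[𝓝 z] 0) : delbar (osculatingMinor g h) z = 0 := by
  have holo {k : ℂ → ℂ} (hk : ContDiffOn ℝ ∞ k Ω) (hk0 : delbar k =ᶠ[𝓝 z] 0) :
      delbar (del k) =ᶠ[𝓝 z] 0 := by
    filter_upwards [hΩ.mem_nhds hz, hk0.eventually_nhds] with w hw hw0
    exact delbar_del_eq_zero hΩ hk hw hw0
  have hdel {k : ℂ → ℂ} (hk : ContDiffOn ℝ ∞ k Ω) := hasWirtingerDerivAt_of_mem hΩ hk hz
  have hg' := contDiffOn_del hΩ hg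
  have hh' := contDiffOn_del hΩ hh
  refine (((hdel hg').mul (hdel (contDiffOn_del hΩ hh'))).sub
    ((hdel (contDiffOn_del hΩ hg')).mul (hdel hh'))).delbar_eq.trans ?_
  rw [delbar_del_eq_zero hΩ hg hz hg0, delbar_del_eq_zero hΩ hh hz hh0,
    delbar_del_eq_zero hΩ hg' hz (holo hg hg0), delbar_del_eq_zero hΩ hh' hz (holo hh hh0)]
  ring

end Minors

section TwistorCoordinates

theorem one_add_mul_conj_ne_zero (c : ℂ) : 1 + c * conj c ≠ 0 := by
  rw [mul_conj]
  exact_mod_cast (by linarith [normSq_nonneg c] : (0 : ℝ) < 1 + normSq c).ne'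

/-- `u = u₁ + j u₂` is a conformal immersion of the planar domain `Ω` whose right normal vector
has the stereographic coordinate `r`: the `∂̄`-part of `du` is `-(∂u₁ + j ∂u₂) j r`. -/
structure TwistorCoordinates (Ω : Set ℂ) (u₁ u₂ r : ℂ → ℂ) : Prop where
  isOpen : IsOpen Ω
  smooth_fst : ContDiffOn ℝ ∞ u₁ Ω
  smooth_snd : ContDiffOn ℝ ∞ u₂ Ω
  smooth_normal : ContDiffOn ℝ ∞ r Ω
  delbar_fst : ∀ z ∈ Ω, delbar u₁ z = r z * conj (del u₂ z)
  delbar_snd : ∀ z ∈ Ω, delbar u₂ z = -(r z * conj (del u₁ z))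
  immersion : ∀ z ∈ Ω, ¬(del u₁ z = 0 ∧ del u₂ z = 0)

/-- The first coordinate of `(u₁ + j u₂) (1 + j r)`; the second one is `twistorLift u₂ (-u₁) r`.
Together with `(1, r)` they are the homogeneous coordinates of the twistor lift. -/
def twistorLift (u₁ u₂ r : ℂ → ℂ) (z : ℂ) : ℂ := u₁ z - r z * conj (u₂ z)

namespace TwistorCoordinates

variable {Ω : Set ℂ} {u₁ u₂ r : ℂ → ℂ} {z : ℂ}

theorem swap (h : TwistorCoordinates Ω u₁ u₂ r) : TwistorCoordinates Ω u₂ (-u₁) r where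
  isOpen := h.isOpen
  smooth_fst := h.smooth_snd
  smooth_snd := h.smooth_fst.neg
  smooth_normal := h.smooth_normal
  delbar_fst z hz := by rw [h.delbar_snd z hz, del_neg, Pi.neg_apply, map_neg, mul_neg]
  delbar_snd z hz := by rw [delbar_neg, Pi.neg_apply, h.delbar_fst z hz]
  immersion z hz := by
    rw [del_neg, Pi.neg_apply, neg_eq_zero, and_comm]
    exact h.immersion z hz

theorem smooth_twistorLift (h : TwistorCoordinates Ω u₁ u₂ r) :
    ContDiffOn ℝ ∞ (twistorLift u₁ u₂ r) Ω :=
  h.smooth_fst.sub (h.smooth_normal.mul (conjCLE.contDiff.comp_contDiffOn h.smooth_snd))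

theorem hasWirtingerDerivAt (h : TwistorCoordinates Ω u₁ u₂ r) {g : ℂ → ℂ}
    (hg : ContDiffOn ℝ ∞ g Ω) (hz : z ∈ Ω) : HasWirtingerDerivAt g (del g z) (delbar g z) z :=
  hasWirtingerDerivAt_of_mem h.isOpen hg hz

theorem codazzi (h : TwistorCoordinates Ω u₁ u₂ r) (hz : z ∈ Ω) :
    (1 + r z * conj (r z)) * delbar (del u₁) z =
      del r z * conj (del u₂ z) - r z * conj (del r z) * del u₁ z := by
  have hr := h.hasWirtingerDerivAt h.smooth_normal hz
  have hp := h.hasWirtingerDerivAt (contDiffOn_del h.isOpen h.smooth_fst) hz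
  have hq := h.hasWirtingerDerivAt (contDiffOn_del h.isOpen h.smooth_snd) hz
  have e₁ := delbar_del h.isOpen h.smooth_fst hz
  have e₂ := delbar_del h.isOpen h.smooth_snd hz
  rw [del_congr ((h.isOpen.eventually_mem hz).mono h.delbar_fst), (hr.mul hq.conj_comp).del_eq]
    at e₁
  rw [del_congr ((h.isOpen.eventually_mem hz).mono h.delbar_snd),
    (hr.mul hp.conj_comp).neg.del_eq] at e₂
  have e₃ := congrArg conj e₂
  simp only [map_neg, map_add, map_mul, conj_conj] at e₃
  linear_combination e₁ + r z * e₃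

theorem del_twistorLift (h : TwistorCoordinates Ω u₁ u₂ r) (hz : z ∈ Ω) :
    del (twistorLift u₁ u₂ r) z =
      (1 + r z * conj (r z)) * del u₁ z - del r z * conj (u₂ z) := by
  refine ((h.hasWirtingerDerivAt h.smooth_fst hz).sub ((h.hasWirtingerDerivAt h.smooth_normal
    hz).mul (h.hasWirtingerDerivAt h.smooth_snd hz).conj_comp)).del_eq.trans ?_
  rw [h.delbar_snd z hz, map_neg, map_mul, conj_conj]
  ring

theorem delbar_twistorLift (h : TwistorCoordinates Ω u₁ u₂ r) (hz : z ∈ Ω) :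
    delbar (twistorLift u₁ u₂ r) z = -(delbar r z * conj (u₂ z)) := by
  refine ((h.hasWirtingerDerivAt h.smooth_fst hz).sub ((h.hasWirtingerDerivAt h.smooth_normal
    hz).mul (h.hasWirtingerDerivAt h.smooth_snd hz).conj_comp)).delbar_eq.trans ?_
  rw [h.delbar_fst z hz]
  ring

theorem del_del_twistorLift (h : TwistorCoordinates Ω u₁ u₂ r) (hz : z ∈ Ω) :
    del (del (twistorLift u₁ u₂ r)) z =
      (1 + r z * conj (r z)) * del (del u₁) z - del (del r) z * conj (u₂ z) +
        (2 * del r z * conj (r z) + r z * conj (delbar r z)) * del u₁ z := by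
  have hr := h.hasWirtingerDerivAt h.smooth_normal hz
  have hr' := h.hasWirtingerDerivAt (contDiffOn_del h.isOpen h.smooth_normal) hz
  have hp := h.hasWirtingerDerivAt (contDiffOn_del h.isOpen h.smooth_fst) hz
  have hu := h.hasWirtingerDerivAt h.smooth_snd hz
  have e : del (twistorLift u₁ u₂ r) =ᶠ[𝓝 z]
      fun w => (del u₁ w + r w * conj (r w) * del u₁ w) - del r w * conj (u₂ w) := by
    filter_upwards [h.isOpen.mem_nhds hz] with w hw
    rw [h.del_twistorLift hw]
    ring
  rw [del_congr e, ((hp.add ((hr.mul hr.conj_comp).mul hp)).sub (hr'.mul hu.conj_comp)).del_eq,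
    h.delbar_snd z hz, map_neg, map_mul, conj_conj]
  ring

theorem osculatingMinor_normal_twistorLift (h : TwistorCoordinates Ω u₁ u₂ r) (hz : z ∈ Ω) :
    osculatingMinor r (twistorLift u₁ u₂ r) z =
      (del r z * (2 * del r z * conj (r z) + r z * conj (delbar r z)) -
        del (del r) z * (1 + r z * conj (r z))) * del u₁ z +
      del r z * (1 + r z * conj (r z)) * del (del u₁) z := by
  rw [osculatingMinor, h.del_twistorLift hz, h.del_del_twistorLift hz]
  ring

theorem osculatingMinor_twistorLift (h : TwistorCoordinates Ω u₁ u₂ r) (hz : z ∈ Ω) :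
    osculatingMinor (twistorLift u₁ u₂ r) (twistorLift u₂ (-u₁) r) z =
      (1 + r z * conj (r z)) ^ 2 * osculatingMinor u₁ u₂ z -
        conj (u₁ z) * osculatingMinor r (twistorLift u₁ u₂ r) z -
        conj (u₂ z) * osculatingMinor r (twistorLift u₂ (-u₁) r) z := by
  simp only [osculatingMinor, h.del_twistorLift hz, h.del_del_twistorLift hz,
    h.swap.del_twistorLift hz, h.swap.del_del_twistorLift hz, Pi.neg_apply, map_neg]
  ring

theorem del_codazzi (h : TwistorCoordinates Ω u₁ u₂ r) (hz : z ∈ Ω) :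
    (del r z * conj (r z) + r z * conj (delbar r z)) * delbar (del u₁) z +
        (1 + r z * conj (r z)) * delbar (del (del u₁)) z =
      del (del r) z * conj (del u₂ z) + del r z * conj (delbar (del u₂) z) -
        (del r z * conj (del r z) + r z * conj (delbar (del r) z)) * del u₁ z -
        r z * conj (del r z) * del (del u₁) z := by
  have hp' := contDiffOn_del h.isOpen h.smooth_fst
  have hr := h.hasWirtingerDerivAt h.smooth_normal hz
  have hr' := h.hasWirtingerDerivAt (contDiffOn_del h.isOpen h.smooth_normal) hz
  have hp := h.hasWirtingerDerivAt hp' hz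
  have hq := h.hasWirtingerDerivAt (contDiffOn_del h.isOpen h.smooth_snd) hz
  have hP := h.hasWirtingerDerivAt (contDiffOn_delbar h.isOpen hp') hz
  have e : (fun w => delbar (del u₁) w + r w * conj (r w) * delbar (del u₁) w) =ᶠ[𝓝 z]
      fun w => del r w * conj (del u₂ w) - r w * conj (del r w) * del u₁ w := by
    filter_upwards [h.isOpen.mem_nhds hz] with w hw
    rw [← h.codazzi hw]
    ring
  have e' := del_congr e
  rw [(hP.add ((hr.mul hr.conj_comp).mul hP)).del_eq,
    ((hr'.mul hq.conj_comp).sub ((hr.mul hr'.conj_comp).mul hp)).del_eq,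
    ← delbar_del h.isOpen hp' hz] at e'
  linear_combination e'

theorem delbar_osculatingMinor (h : TwistorCoordinates Ω u₁ u₂ r) (hz : z ∈ Ω) :
    (1 + r z * conj (r z)) ^ 2 * delbar (osculatingMinor u₁ u₂) z =
      conj (del u₁ z) * osculatingMinor r (twistorLift u₁ u₂ r) z +
        conj (del u₂ z) * osculatingMinor r (twistorLift u₂ (-u₁) r) z -
        2 * (1 + r z * conj (r z)) * r z * conj (del r z) * osculatingMinor u₁ u₂ z := by
  have hp' := contDiffOn_del h.isOpen h.smooth_fst
  have hq' := contDiffOn_del h.isOpen h.smooth_snd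
  have hW := (((h.hasWirtingerDerivAt hp' hz).mul
    (h.hasWirtingerDerivAt (contDiffOn_del h.isOpen hq') hz)).sub
    ((h.hasWirtingerDerivAt (contDiffOn_del h.isOpen hp') hz).mul
    (h.hasWirtingerDerivAt hq' hz))).delbar_eq
  have c₁ := h.codazzi hz
  have c₂ := h.swap.codazzi hz
  have d₁ := h.del_codazzi hz
  have d₂ := h.swap.del_codazzi hz
  have c₁' := congrArg conj c₁
  have c₂' := congrArg conj c₂
  rw [h.osculatingMinor_normal_twistorLift hz, h.swap.osculatingMinor_normal_twistorLift hz]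
  simp only [del_neg, delbar_neg, Pi.neg_apply, map_neg, map_add, map_sub, map_mul, map_one,
    conj_conj] at c₂ d₂ c₁' c₂'
  refine (congrArg _ hW).trans ?_
  rw [osculatingMinor]
  linear_combination
    ((1 + r z * conj (r z)) * del (del u₂) z +
        (del r z * conj (r z) + r z * conj (delbar r z)) * del u₂ z) * c₁ -
      ((1 + r z * conj (r z)) * del (del u₁) z +
        (del r z * conj (r z) + r z * conj (delbar r z)) * del u₁ z) * c₂ +
      (1 + r z * conj (r z)) * (del u₁ z * d₂ - del u₂ z * d₁) -
      del r z * (del u₁ z * c₁' + del u₂ z * c₂')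

/-- The osculating minors of the twistor lift `(1, r, a₁, a₂)` all vanish at `z`. -/
structure OsculatingMinorsVanish (u₁ u₂ r : ℂ → ℂ) (z : ℂ) : Prop where
  normal_fst : osculatingMinor r (twistorLift u₁ u₂ r) z = 0
  normal_snd : osculatingMinor r (twistorLift u₂ (-u₁) r) z = 0
  fst_snd : osculatingMinor (twistorLift u₁ u₂ r) (twistorLift u₂ (-u₁) r) z = 0

theorem osculatingMinor_eq_zero (h : TwistorCoordinates Ω u₁ u₂ r) (hz : z ∈ Ω)
    (hm : OsculatingMinorsVanish u₁ u₂ r z) : osculatingMinor u₁ u₂ z = 0 := by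
  have e := h.osculatingMinor_twistorLift hz
  rw [hm.normal_fst, hm.normal_snd, hm.fst_snd, mul_zero, mul_zero, sub_zero, sub_zero] at e
  exact (mul_eq_zero.1 e.symm).resolve_left (pow_ne_zero 2 (one_add_mul_conj_ne_zero _))

theorem osculatingMinorsVanish (h : TwistorCoordinates Ω u₁ u₂ r) (hz : z ∈ Ω)
    (h0 : osculatingMinor u₁ u₂ =ᶠ[𝓝 z] 0) : OsculatingMinorsVanish u₁ u₂ r z := by
  set p := del u₁ z
  set q := del u₂ z
  set m₁ := osculatingMinor r (twistorLift u₁ u₂ r) z with hm₁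
  set m₂ := osculatingMinor r (twistorLift u₂ (-u₁) r) z with hm₂
  have hW : p * del (del u₂) z - del (del u₁) z * q = 0 := h0.self_of_nhds
  have e₁ : conj p * m₁ + conj q * m₂ = 0 := by
    have e := h.delbar_osculatingMinor hz
    rw [delbar_congr h0, h0.self_of_nhds] at e
    have e0 : delbar (0 : ℂ → ℂ) z = 0 := delbar_const 0 z
    rw [e0, Pi.zero_apply] at e
    linear_combination -e
  have e₂ : p * m₂ - q * m₁ = 0 := by
    rw [hm₁, hm₂, h.osculatingMinor_normal_twistorLift hz,
      h.swap.osculatingMinor_normal_twistorLift hz]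
    linear_combination (del r z * (1 + r z * conj (r z))) * hW
  have hpq : p * conj p + q * conj q ≠ 0 := by
    rw [mul_conj, mul_conj]
    intro e
    have e' : normSq p + normSq q = 0 := by exact_mod_cast e
    have := normSq_nonneg p
    have := normSq_nonneg q
    exact h.immersion z hz ⟨normSq_eq_zero.1 (by linarith), normSq_eq_zero.1 (by linarith)⟩
  have h₁ : m₁ = 0 := (mul_eq_zero.1 (by linear_combination p * e₁ - conj q * e₂ :
    (p * conj p + q * conj q) * m₁ = 0)).resolve_left hpq
  have h₂ : m₂ = 0 := (mul_eq_zero.1 (by linear_combination q * e₁ + conj p * e₂ :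
    (p * conj p + q * conj q) * m₂ = 0)).resolve_left hpq
  refine ⟨h₁, h₂, ?_⟩
  rw [h.osculatingMinor_twistorLift hz, ← hm₁, ← hm₂, h₁, h₂, h0.self_of_nhds]
  simp

end TwistorCoordinates

end TwistorCoordinates

section IdentityTheorem

theorem eqOn_zero_of_forall_eventuallyEq_or_ne {X E G : Type*} [TopologicalSpace X]
    [TopologicalSpace E] [T1Space E] [Zero E] [Zero G] {Ω : Set X} (hΩ : IsOpen Ω) {m : X → E}
    {s : X → G} (hm : ContinuousOn m Ω) (h0 : ∀ z ∈ Ω, s =ᶠ[𝓝 z] 0 → m z = 0)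
    (h1 : ∀ z ∈ Ω, s z ≠ 0 → m z = 0) : Set.EqOn m 0 Ω := by
  intro z hz
  by_contra hne
  refine hne (h0 z hz ?_)
  filter_upwards [(hm.continuousAt (hΩ.mem_nhds hz)).eventually_ne hne, hΩ.mem_nhds hz]
    with w hw hwΩ
  by_contra hsw
  exact hw (h1 w hwΩ hsw)

namespace TwistorCoordinates

variable {Ω : Set ℂ} {u₁ u₂ r : ℂ → ℂ} {z₀ : ℂ}

theorem eqOn_zero_of_dichotomy (h : TwistorCoordinates Ω u₁ u₂ r) (hΩ : IsPreconnected Ω)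
    (hdich : ∀ z ∈ Ω, delbar r z = 0 ∨ osculatingMinor u₁ u₂ z = 0) (hz₀ : z₀ ∈ Ω)
    (hz₀W : osculatingMinor u₁ u₂ =ᶠ[𝓝 z₀] 0) {m : ℂ → ℂ} (hm : ContDiffOn ℝ ∞ m Ω)
    (hmr : ∀ z ∈ Ω, delbar r =ᶠ[𝓝 z] 0 → delbar m z = 0)
    (hmW : ∀ z ∈ Ω, osculatingMinor u₁ u₂ =ᶠ[𝓝 z] 0 → m z = 0) : Set.EqOn m 0 Ω := by
  have eventually_zero {z : ℂ} (hz : z ∈ Ω) (hW : osculatingMinor u₁ u₂ =ᶠ[𝓝 z] 0) :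
      m =ᶠ[𝓝 z] 0 := by
    filter_upwards [hW.eventually_nhds, h.isOpen.mem_nhds hz] with w hwW hw
    exact hmW w hw hwW
  have hdelbar : Set.EqOn (delbar m) 0 Ω := by
    refine eqOn_zero_of_forall_eventuallyEq_or_ne h.isOpen
      (contDiffOn_delbar h.isOpen hm).continuousOn hmr fun z hz hne => ?_
    have hW : osculatingMinor u₁ u₂ =ᶠ[𝓝 z] 0 := by
      filter_upwards [((contDiffOn_delbar h.isOpen h.smooth_normal).continuousOn.continuousAt
        (h.isOpen.mem_nhds hz)).eventually_ne hne, h.isOpen.mem_nhds hz] with w hw hwΩ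
      exact (hdich w hwΩ).resolve_left hw
    exact (delbar_congr (eventually_zero hz hW)).trans (delbar_const 0 z)
  have hholo : DifferentiableOn ℂ m Ω := fun z hz => (differentiableAt_iff_delbar_eq_zero.2
    ⟨differentiableAt_of_contDiffOn h.isOpen hm hz, hdelbar hz⟩).differentiableWithinAt
  exact (hholo.analyticOnNhd h.isOpen).eqOn_zero_of_preconnected_of_eventuallyEq_zero hΩ hz₀
    (eventually_zero hz₀ hz₀W)

theorem osculatingMinor_eqOn_zero (h : TwistorCoordinates Ω u₁ u₂ r) (hΩ : IsPreconnected Ω)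
    (hdich : ∀ z ∈ Ω, delbar r z = 0 ∨ osculatingMinor u₁ u₂ z = 0) (hz₀ : z₀ ∈ Ω)
    (hz₀W : osculatingMinor u₁ u₂ =ᶠ[𝓝 z₀] 0) : Set.EqOn (osculatingMinor u₁ u₂) 0 Ω := by
  have vanish {g k : ℂ → ℂ} (hg : ContDiffOn ℝ ∞ g Ω) (hk : ContDiffOn ℝ ∞ k Ω)
      (hgr : ∀ z ∈ Ω, delbar r z = 0 → delbar g z = 0)
      (hkr : ∀ z ∈ Ω, delbar r z = 0 → delbar k z = 0)
      (hgk : ∀ z ∈ Ω, osculatingMinor u₁ u₂ =ᶠ[𝓝 z] 0 → osculatingMinor g k z = 0) :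
      Set.EqOn (osculatingMinor g k) 0 Ω := by
    refine h.eqOn_zero_of_dichotomy hΩ hdich hz₀ hz₀W (contDiffOn_osculatingMinor h.isOpen hg hk)
      (fun z hz hr => delbar_osculatingMinor_eq_zero h.isOpen hg hk hz ?_ ?_) hgk
    · filter_upwards [hr, h.isOpen.mem_nhds hz] with w hw hwΩ using hgr w hwΩ hw
    · filter_upwards [hr, h.isOpen.mem_nhds hz] with w hw hwΩ using hkr w hwΩ hw
  have lift_fst : ∀ z ∈ Ω, delbar r z = 0 → delbar (twistorLift u₁ u₂ r) z = 0 :=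
    fun z hz hr => by rw [h.delbar_twistorLift hz, hr, zero_mul, neg_zero]
  have lift_snd : ∀ z ∈ Ω, delbar r z = 0 → delbar (twistorLift u₂ (-u₁) r) z = 0 :=
    fun z hz hr => by rw [h.swap.delbar_twistorLift hz, hr, zero_mul, neg_zero]
  intro z hz
  exact h.osculatingMinor_eq_zero hz
    ⟨vanish h.smooth_normal h.smooth_twistorLift (fun _ _ => id) lift_fst
      (fun w hw hW => (h.osculatingMinorsVanish hw hW).normal_fst) hz,
    vanish h.smooth_normal h.swap.smooth_twistorLift (fun _ _ => id) lift_snd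
      (fun w hw hW => (h.osculatingMinorsVanish hw hW).normal_snd) hz,
    vanish h.smooth_twistorLift h.swap.smooth_twistorLift lift_fst lift_snd
      (fun w hw hW => (h.osculatingMinorsVanish hw hW).fst_snd) hz⟩

end TwistorCoordinates

end IdentityTheorem

/-! ### Quaternions as pairs of complex numbers -/

section Quaternions

/-- The quaternion `i`. -/
def quatI : ℍ[ℝ] := (I : ℂ)

/-- The coordinate `a` of `a + j b ∈ ℂ + j ℂ = ℍ`. -/
def complexFst : ℍ[ℝ] →L[ℝ] ℂ :=
  LinearMap.toContinuousLinearMap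
    { toFun := fun x => ⟨x.re, x.imI⟩
      map_add' := fun _ _ => rfl
      map_smul' := fun _ _ => by apply Complex.ext <;> simp }

/-- The coordinate `b` of `a + j b ∈ ℂ + j ℂ = ℍ`; the sign in it comes from `j i = -k`. -/
def complexSnd : ℍ[ℝ] →L[ℝ] ℂ :=
  LinearMap.toContinuousLinearMap
    { toFun := fun x => ⟨x.imJ, -x.imK⟩
      map_add' := fun _ _ => by apply Complex.ext <;> simp; ring
      map_smul' := fun _ _ => by apply Complex.ext <;> simp }

variable {K N l a x y : ℍ[ℝ]}

theorem complexFst_apply (x : ℍ[ℝ]) : complexFst x = ⟨x.re, x.imI⟩ := rfl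

theorem complexSnd_apply (x : ℍ[ℝ]) : complexSnd x = ⟨x.imJ, -x.imK⟩ := rfl

theorem ext_complex (h₁ : complexFst x = complexFst y) (h₂ : complexSnd x = complexSnd y) :
    x = y := by
  rw [complexFst_apply, complexFst_apply, Complex.mk.injEq] at h₁
  rw [complexSnd_apply, complexSnd_apply, Complex.mk.injEq, neg_inj] at h₂
  exact QuaternionAlgebra.ext h₁.1 h₁.2 h₂.1 h₂.2

theorem complexFst_mul (x y : ℍ[ℝ]) :
    complexFst (x * y) = complexFst x * complexFst y - conj (complexSnd x) * complexSnd y := by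
  apply Complex.ext <;> simp [complexFst_apply, complexSnd_apply] <;> ring

theorem complexSnd_mul (x y : ℍ[ℝ]) :
    complexSnd (x * y) = complexSnd x * complexFst y + conj (complexFst x) * complexSnd y := by
  apply Complex.ext <;> simp [complexFst_apply, complexSnd_apply] <;> ring

theorem complexFst_one : complexFst 1 = 1 := by apply Complex.ext <;> simp [complexFst_apply]

theorem complexSnd_one : complexSnd 1 = 0 := by apply Complex.ext <;> simp [complexSnd_apply]

theorem complexFst_coe (c : ℂ) : complexFst c = c := rfl

theorem complexSnd_coe (c : ℂ) : complexSnd c = 0 := by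
  apply Complex.ext <;> simp [complexSnd_apply]

theorem complexFst_quatI : complexFst quatI = I := rfl

theorem complexSnd_quatI : complexSnd quatI = 0 := complexSnd_coe I

theorem complexFst_quatJ : complexFst quatJ = 0 := rfl

theorem complexSnd_quatJ : complexSnd quatJ = 1 := Complex.ext rfl neg_zero

theorem quatJ_ne_zero : quatJ ≠ 0 := fun h => by
  have h' := complexSnd_quatJ
  rw [h, map_zero] at h'
  exact zero_ne_one h'

theorem coe_complexFst_add (x : ℍ[ℝ]) : complexFst x + quatJ * complexSnd x = x := by
  apply ext_complex <;> simp [complexFst_mul, complexSnd_mul, complexFst_coe, complexSnd_coe,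
    complexFst_quatJ, complexSnd_quatJ]

theorem quatI_mul_quatI : quatI * quatI = -1 := by
  rw [quatI, ← Quaternion.coeComplex_mul, I_mul_I]
  ext <;> simp

theorem quatI_mul_quatJ : quatI * quatJ = -(quatJ * quatI) := by
  apply ext_complex <;> simp [complexFst_mul, complexSnd_mul, complexFst_quatI, complexSnd_quatI,
    complexFst_quatJ, complexSnd_quatJ]

theorem coe_mul_quatI (c : ℂ) : c * quatI = quatI * c := by
  rw [quatI, ← Quaternion.coeComplex_mul, ← Quaternion.coeComplex_mul, mul_comm]

theorem quatI_ne_zero : quatI ≠ 0 := fun h => by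
  have h' := quatI_mul_quatI
  rw [h, mul_zero] at h'
  exact neg_ne_zero.2 one_ne_zero h'.symm

theorem exists_coe_of_commute_quatI (h : x * quatI = quatI * x) : ∃ c : ℂ, x = c := by
  have h' := congrArg complexSnd h
  simp only [complexSnd_mul, complexFst_quatI, complexSnd_quatI, conj_I, mul_zero, zero_mul,
    add_zero, zero_add] at h'
  have h0 : complexSnd x = 0 :=
    (mul_eq_zero.1 (by linear_combination h' : complexSnd x * (2 * I) = 0)).resolve_right (by simp)
  exact ⟨complexFst x, ext_complex rfl (h0.trans (complexSnd_coe _).symm)⟩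

theorem mul_eq_neg_mul_quatI_iff_exists_coe (hl0 : l ≠ 0) (hl : K * l = -(l * quatI)) :
    K * a = -(a * quatI) ↔ ∃ c : ℂ, a = l * c := by
  constructor
  · intro ha
    have h : l * (l⁻¹ * a * quatI) = l * (quatI * (l⁻¹ * a)) := by
      rw [← mul_assoc l quatI, ← neg_eq_iff_eq_neg.2 hl, neg_mul, mul_assoc K, mul_assoc,
        mul_inv_cancel_left₀ hl0, mul_inv_cancel_left₀ hl0, ha, neg_neg]
    obtain ⟨c, hc⟩ := exists_coe_of_commute_quatI (mul_left_cancel₀ hl0 h)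
    exact ⟨c, by rw [← hc, mul_inv_cancel_left₀ hl0]⟩
  · rintro ⟨c, rfl⟩
    rw [← mul_assoc, hl, neg_mul, mul_assoc, mul_assoc, coe_mul_quatI]

theorem exists_eq_mul_coe_iff (hl0 : l ≠ 0) :
    (∃ c : ℂ, a = l * c) ↔ complexFst l * complexSnd a - complexFst a * complexSnd l = 0 := by
  constructor
  · rintro ⟨c, rfl⟩
    simp only [complexFst_mul, complexSnd_mul, complexFst_coe, complexSnd_coe]
    ring
  · intro h
    by_cases h1 : complexFst l = 0
    · have h2 : complexSnd l ≠ 0 := fun h2 => hl0 (ext_complex (by simp [h1]) (by simp [h2]))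
      refine ⟨complexSnd a / complexSnd l, ext_complex ?_ ?_⟩
      · rw [complexFst_mul, complexFst_coe, complexSnd_coe, h1]
        rw [h1, zero_mul, zero_sub, neg_eq_zero, mul_eq_zero] at h
        simpa using h.resolve_right h2
      · rw [complexSnd_mul, complexFst_coe, complexSnd_coe, mul_div_cancel₀ _ h2]
        simp
    · refine ⟨complexFst a / complexFst l, ext_complex ?_ ?_⟩
      · rw [complexFst_mul, complexFst_coe, complexSnd_coe, mul_div_cancel₀ _ h1]
        simp
      · rw [complexSnd_mul, complexFst_coe, complexSnd_coe]
        field_simp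
        linear_combination h

theorem exists_mul_eq_neg_mul_quatI (hK : K * K = -1) :
    ∃ l : ℍ[ℝ], l ≠ 0 ∧ K * l = -(l * quatI) := by
  by_cases h : 1 + K * quatI = 0
  · have hKi : K = quatI := by
      rw [← mul_one K, ← neg_neg (1 : ℍ[ℝ]), ← quatI_mul_quatI, mul_neg, ← mul_assoc,
        ← neg_eq_iff_add_eq_zero.2 h]
      simp
    exact ⟨quatJ, quatJ_ne_zero, by rw [hKi, quatI_mul_quatJ]⟩
  · refine ⟨1 + K * quatI, h, ?_⟩
    rw [mul_add, ← mul_assoc, hK, add_mul, mul_assoc, quatI_mul_quatI]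
    noncomm_ring

end Quaternions

/-! ### Holomorphic normal vectors -/

section Normals

theorem fderiv_mul_self_anticomm {E : Type*} [NormedAddCommGroup E] [NormedSpace ℝ E]
    {K : E → ℍ[ℝ]} {z : E} (hK : DifferentiableAt ℝ K z) (hsq : ∀ᶠ w in 𝓝 z, K w * K w = -1)
    (X : E) : fderiv ℝ K z X * K z = -(K z * fderiv ℝ K z X) := by
  have h := (hK.hasFDerivAt.mul' hK.hasFDerivAt).unique
    ((hasFDerivAt_const (-1 : ℍ[ℝ]) z).congr_of_eventuallyEq hsq)
  have hX := congrArg (fun L => L X) h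
  simp only [add_apply, smul_apply, zero_apply, smul_eq_mul, MulOpposite.smul_eq_mul_unop,
    MulOpposite.unop_op] at hX
  rw [← neg_eq_iff_add_eq_zero, eq_comm] at hX
  exact hX

theorem sub_mul_fderiv_mul_eq {E : Type*} [NormedAddCommGroup E] [NormedSpace ℝ E]
    {K l : E → ℍ[ℝ]} {z : E} (hK : DifferentiableAt ℝ K z) (hl : DifferentiableAt ℝ l z)
    (hsq : ∀ᶠ w in 𝓝 z, K w * K w = -1) (hKl : ∀ᶠ w in 𝓝 z, K w * l w = -(l w * quatI))
    (X Y : E) : (fderiv ℝ K z Y - K z * fderiv ℝ K z X) * l z * quatI =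
      -(K z * (fderiv ℝ l z X + fderiv ℝ l z Y * quatI) +
        (fderiv ℝ l z X + fderiv ℝ l z Y * quatI) * quatI) := by
  have deriv_eq (Z : E) :
      fderiv ℝ K z Z * l z = -(fderiv ℝ l z Z * quatI) - K z * fderiv ℝ l z Z := by
    have h := (hK.hasFDerivAt.mul' hl.hasFDerivAt).unique
      ((hl.hasFDerivAt.mul_const' quatI).neg.congr_of_eventuallyEq hKl)
    have hZ := congrArg (fun L => L Z) h
    simp only [add_apply, smul_apply, neg_apply, smul_eq_mul, MulOpposite.smul_eq_mul_unop,
      MulOpposite.unop_op] at hZ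
    rw [← hZ, add_sub_cancel_left]
  have hX : K z * fderiv ℝ K z X * l z = fderiv ℝ K z X * l z * quatI := by
    rw [← neg_inj, ← neg_mul, ← fderiv_mul_self_anticomm hK hsq, mul_assoc,
      hKl.self_of_nhds, mul_neg, mul_assoc]
  rw [sub_mul, hX, deriv_eq, deriv_eq]
  simp only [sub_mul, add_mul, mul_add, neg_mul, mul_assoc, quatI_mul_quatI]
  noncomm_ring

theorem fderiv_eq_mul_fderiv_iff {E : Type*} [NormedAddCommGroup E] [NormedSpace ℝ E]
    {K l : E → ℍ[ℝ]} {z : E} (hK : DifferentiableAt ℝ K z) (hl : DifferentiableAt ℝ l z)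
    (hsq : ∀ᶠ w in 𝓝 z, K w * K w = -1) (hl0 : l z ≠ 0)
    (hKl : ∀ᶠ w in 𝓝 z, K w * l w = -(l w * quatI)) (X Y : E) :
    fderiv ℝ K z Y = K z * fderiv ℝ K z X ↔
      K z * (fderiv ℝ l z X + fderiv ℝ l z Y * quatI) =
        -((fderiv ℝ l z X + fderiv ℝ l z Y * quatI) * quatI) := by
  rw [← sub_eq_zero, eq_neg_iff_add_eq_zero, ← neg_eq_zero (a := _ + _),
    ← sub_mul_fderiv_mul_eq hK hl hsq hKl, mul_eq_zero, mul_eq_zero, or_iff_left quatI_ne_zero,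
    or_iff_left hl0]

/-- The Wirtinger derivative `∂g = (g_x - g_y i) / 2` with respect to the complex structure of `ℍ`
given by right multiplication by `i`. -/
def rightDel (g : ℂ → ℍ[ℝ]) (z : ℂ) : ℍ[ℝ] :=
  (2 : ℝ)⁻¹ • (fderiv ℝ g z 1 - fderiv ℝ g z I * quatI)

/-- The Wirtinger derivative `∂̄g = (g_x + g_y i) / 2` with respect to the complex structure of `ℍ`
given by right multiplication by `i`. -/
def rightDelbar (g : ℂ → ℍ[ℝ]) (z : ℂ) : ℍ[ℝ] :=
  (2 : ℝ)⁻¹ • (fderiv ℝ g z 1 + fderiv ℝ g z I * quatI)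

variable {g K N l : ℂ → ℍ[ℝ]} {z : ℂ}

theorem fderiv_clm_comp {E F G : Type*} [NormedAddCommGroup E] [NormedSpace ℝ E]
    [NormedAddCommGroup F] [NormedSpace ℝ F] [NormedAddCommGroup G] [NormedSpace ℝ G]
    (L : F →L[ℝ] G) {g : E → F} {z : E} (hg : DifferentiableAt ℝ g z) (X : E) :
    fderiv ℝ (fun w => L (g w)) z X = L (fderiv ℝ g z X) :=
  DFunLike.congr_fun (L.hasFDerivAt.comp z hg.hasFDerivAt).fderiv X

theorem complexFst_rightDel (hg : DifferentiableAt ℝ g z) :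
    complexFst (rightDel g z) = del (fun w => complexFst (g w)) z := by
  simp [rightDel, del, fderiv_clm_comp _ hg, complexFst_mul, complexFst_quatI,
    complexSnd_quatI, mul_comm I]

theorem complexSnd_rightDel (hg : DifferentiableAt ℝ g z) :
    complexSnd (rightDel g z) = del (fun w => complexSnd (g w)) z := by
  simp [rightDel, del, fderiv_clm_comp _ hg, complexSnd_mul, complexFst_quatI,
    complexSnd_quatI, mul_comm I]

theorem complexFst_rightDelbar (hg : DifferentiableAt ℝ g z) :
    complexFst (rightDelbar g z) = delbar (fun w => complexFst (g w)) z := by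
  simp [rightDelbar, delbar, fderiv_clm_comp _ hg, complexFst_mul, complexFst_quatI,
    complexSnd_quatI, mul_comm I, mul_add]

theorem complexSnd_rightDelbar (hg : DifferentiableAt ℝ g z) :
    complexSnd (rightDelbar g z) = delbar (fun w => complexSnd (g w)) z := by
  simp [rightDelbar, delbar, fderiv_clm_comp _ hg, complexSnd_mul, complexFst_quatI,
    complexSnd_quatI, mul_comm I, mul_add]

theorem mul_smul_eq_neg_mul_quatI_iff {K a : ℍ[ℝ]} {t : ℝ} (ht : t ≠ 0) :
    K * (t • a) = -(t • a * quatI) ↔ K * a = -(a * quatI) := by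
  rw [mul_smul_comm, smul_mul_assoc, ← smul_neg]
  exact (smul_right_injective _ ht).eq_iff

theorem fderiv_eq_mul_fderiv_iff_delbar (hK : DifferentiableAt ℝ K z)
    (hl : DifferentiableAt ℝ l z) (hsq : ∀ᶠ w in 𝓝 z, K w * K w = -1) (hl0 : l z ≠ 0)
    (hKl : ∀ᶠ w in 𝓝 z, K w * l w = -(l w * quatI)) :
    fderiv ℝ K z I = K z * fderiv ℝ K z 1 ↔
      complexFst (l z) * delbar (fun w => complexSnd (l w)) z -
        delbar (fun w => complexFst (l w)) z * complexSnd (l z) = 0 := by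
  rw [fderiv_eq_mul_fderiv_iff hK hl hsq hl0 hKl, ← complexFst_rightDelbar hl,
    ← complexSnd_rightDelbar hl, ← exists_eq_mul_coe_iff hl0,
    ← mul_eq_neg_mul_quatI_iff_exists_coe hl0 hKl.self_of_nhds, rightDelbar,
    mul_smul_eq_neg_mul_quatI_iff (by norm_num)]

theorem fderiv_eq_mul_fderiv_iff_del (hN : DifferentiableAt ℝ N z) (hl : DifferentiableAt ℝ l z)
    (hsq : ∀ᶠ w in 𝓝 z, N w * N w = -1) (hl0 : l z ≠ 0)
    (hNl : ∀ᶠ w in 𝓝 z, N w * l w = l w * quatI) :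
    fderiv ℝ N z I = N z * fderiv ℝ N z 1 ↔
      complexFst (l z) * del (fun w => complexSnd (l w)) z -
        del (fun w => complexFst (l w)) z * complexSnd (l z) = 0 := by
  have hNl' : ∀ᶠ w in 𝓝 z, -N w * l w = -(l w * quatI) := hNl.mono fun w hw => by rw [neg_mul, hw]
  have hsq' : ∀ᶠ w in 𝓝 z, -N w * -N w = -1 := hsq.mono fun w hw => by rw [neg_mul_neg, hw]
  have h := fderiv_eq_mul_fderiv_iff hN.neg hl hsq' hl0 hNl' I 1
  have hneg : fderiv ℝ (-N) z 1 = (-N) z * fderiv ℝ (-N) z I ↔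
      fderiv ℝ N z I = N z * fderiv ℝ N z 1 := by
    rw [fderiv_neg, neg_apply, neg_apply, Pi.neg_apply, neg_mul_neg]
    refine ⟨fun e => ?_, fun e => ?_⟩
    · rw [← neg_inj, ← mul_neg, e, ← mul_assoc, hsq.self_of_nhds, neg_one_mul]
    · rw [e, ← mul_assoc, hsq.self_of_nhds, neg_one_mul]
  have hdir : fderiv ℝ l z I + fderiv ℝ l z 1 * quatI = (2 : ℝ) • rightDel l z * quatI := by
    rw [rightDel, smul_inv_smul₀ two_ne_zero, sub_mul, mul_assoc, quatI_mul_quatI]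
    noncomm_ring
  rw [← hneg, h, Pi.neg_apply, mul_eq_neg_mul_quatI_iff_exists_coe hl0 hNl'.self_of_nhds,
    exists_eq_mul_coe_iff hl0, hdir, ← complexFst_rightDel hl, ← complexSnd_rightDel hl]
  have factor : complexFst (l z) * complexSnd ((2 : ℝ) • rightDel l z * quatI) -
      complexFst ((2 : ℝ) • rightDel l z * quatI) * complexSnd (l z) =
      2 * I * (complexFst (l z) * complexSnd (rightDel l z) -
        complexFst (rightDel l z) * complexSnd (l z)) := by
    simp only [complexFst_mul, complexSnd_mul, complexFst_quatI, complexSnd_quatI, map_smul,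
      real_smul]
    push_cast
    ring
  rw [factor, mul_eq_zero, or_iff_right (by simp)]

end Normals

section PlanarDomain

/-- `F` is a conformal immersion of the planar domain `Ω` into `ℍ` with left normal vector `N` and
right normal vector `R`. -/
structure ConformalOn (Ω : Set ℂ) (F N R : ℂ → ℍ[ℝ]) : Prop where
  isOpen : IsOpen Ω
  smooth : ContDiffOn ℝ ∞ F Ω
  smooth_left : ContDiffOn ℝ ∞ N Ω
  smooth_right : ContDiffOn ℝ ∞ R Ω
  sq_left : ∀ z ∈ Ω, N z * N z = -1
  sq_right : ∀ z ∈ Ω, R z * R z = -1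
  left : ∀ z ∈ Ω, fderiv ℝ F z I = N z * fderiv ℝ F z 1
  right : ∀ z ∈ Ω, fderiv ℝ F z I = -(fderiv ℝ F z 1 * R z)
  fderiv_one_ne_zero : ∀ z ∈ Ω, fderiv ℝ F z 1 ≠ 0

/-- The coordinate `r` of the square root `K` of `-1` for which `K (1 + j r) = -(1 + j r) i`; the
solutions `x` of `K x = -x i` are the complex multiples of `1 + K i`. The value is junk for the
one root `K = i` which has no such coordinate. -/
def stereographic (K : ℍ[ℝ]) : ℂ := complexSnd (1 + K * quatI) / complexFst (1 + K * quatI)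

theorem complexFst_one_add_quatJ_mul (c : ℂ) : complexFst (1 + quatJ * c) = 1 := by
  simp [complexFst_mul, complexFst_one, complexFst_coe, complexSnd_coe, complexFst_quatJ]

theorem complexSnd_one_add_quatJ_mul (c : ℂ) : complexSnd (1 + quatJ * c) = c := by
  simp [complexSnd_mul, complexSnd_one, complexFst_coe, complexSnd_coe, complexFst_quatJ,
    complexSnd_quatJ]

theorem mul_one_add_quatJ_mul_stereographic {K : ℍ[ℝ]} (hK : K * K = -1)
    (h0 : complexFst (1 + K * quatI) ≠ 0) :
    K * (1 + quatJ * stereographic K) = -((1 + quatJ * stereographic K) * quatI) := by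
  have hl : K * (1 + K * quatI) = -((1 + K * quatI) * quatI) := by
    rw [mul_add, ← mul_assoc, hK, add_mul, mul_assoc, quatI_mul_quatI]
    noncomm_ring
  refine (mul_eq_neg_mul_quatI_iff_exists_coe (fun h => h0 (by rw [h, map_zero])) hl).2
    ⟨(complexFst (1 + K * quatI))⁻¹, ext_complex ?_ ?_⟩
  · rw [complexFst_mul (1 + K * quatI), complexFst_coe, complexSnd_coe, mul_inv_cancel₀ h0,
      mul_zero, sub_zero]
    exact complexFst_one_add_quatJ_mul _
  · rw [complexSnd_mul (1 + K * quatI), complexFst_coe, complexSnd_coe, mul_zero, add_zero,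
      ← div_eq_mul_inv]
    exact complexSnd_one_add_quatJ_mul _

theorem contDiffOn_stereographic {K : ℂ → ℍ[ℝ]} {Ω : Set ℂ} (hK : ContDiffOn ℝ ∞ K Ω)
    (h0 : ∀ z ∈ Ω, complexFst (1 + K z * quatI) ≠ 0) :
    ContDiffOn ℝ ∞ (fun z => stereographic (K z)) Ω := by
  have h : ContDiffOn ℝ ∞ (fun z => 1 + K z * quatI) Ω :=
    contDiffOn_const.add (hK.mul contDiffOn_const)
  have h1 := complexFst.contDiff.comp_contDiffOn h
  have h2 := complexSnd.contDiff.comp_contDiffOn h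
  exact h2.mul (h1.inv h0)

theorem fderiv_conj_eq_mul {K : ℂ → ℍ[ℝ]} {z X Y : ℂ} {l : ℍ[ℝ]} (hK : DifferentiableAt ℝ K z)
    (hl : l ≠ 0) (h : fderiv ℝ K z Y = K z * fderiv ℝ K z X) :
    fderiv ℝ (fun w => l⁻¹ * K w * l) z Y =
      l⁻¹ * K z * l * fderiv ℝ (fun w => l⁻¹ * K w * l) z X := by
  have hd : ∀ V, fderiv ℝ (fun w => l⁻¹ * K w * l) z V = l⁻¹ * fderiv ℝ K z V * l := fun V => by
    rw [fderiv_mul_const' (hK.const_mul _), fderiv_const_mul hK]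
    rfl
  rw [hd, hd, h, mul_assoc (l⁻¹ * K z), mul_assoc l⁻¹ (fderiv ℝ K z X), mul_inv_cancel_left₀ hl]
  simp only [mul_assoc]

namespace ConformalOn

variable {Ω Ω' : Set ℂ} {F N R : ℂ → ℍ[ℝ]} {z z₀ : ℂ}

theorem mono (h : ConformalOn Ω F N R) (hΩ' : IsOpen Ω') (hsub : Ω' ⊆ Ω) :
    ConformalOn Ω' F N R where
  isOpen := hΩ'
  smooth := h.smooth.mono hsub
  smooth_left := h.smooth_left.mono hsub
  smooth_right := h.smooth_right.mono hsub
  sq_left z hz := h.sq_left z (hsub hz)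
  sq_right z hz := h.sq_right z (hsub hz)
  left z hz := h.left z (hsub hz)
  right z hz := h.right z (hsub hz)
  fderiv_one_ne_zero z hz := h.fderiv_one_ne_zero z (hsub hz)

theorem differentiableAt (h : ConformalOn Ω F N R) {E : Type*} [NormedAddCommGroup E]
    [NormedSpace ℝ E] {g : ℂ → E} (hg : ContDiffOn ℝ ∞ g Ω) (hz : z ∈ Ω) :
    DifferentiableAt ℝ g z :=
  differentiableAt_of_contDiffOn h.isOpen hg hz

theorem mul_const (h : ConformalOn Ω F N R) {l : ℍ[ℝ]} (hl : l ≠ 0) :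
    ConformalOn Ω (fun z => F z * l) N (fun z => l⁻¹ * R z * l) := by
  have hd : ∀ z ∈ Ω, ∀ X, fderiv ℝ (fun z => F z * l) z X = fderiv ℝ F z X * l := fun z hz X => by
    rw [fderiv_mul_const' (h.differentiableAt h.smooth hz)]
    rfl
  refine ⟨h.isOpen, h.smooth.mul contDiffOn_const, h.smooth_left,
    (contDiffOn_const.mul h.smooth_right).mul contDiffOn_const, h.sq_left, fun z hz => ?_,
    fun z hz => ?_, fun z hz => ?_, fun z hz => ?_⟩
  · calc l⁻¹ * R z * l * (l⁻¹ * R z * l) = l⁻¹ * R z * (l * l⁻¹) * R z * l := by noncomm_ring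
      _ = l⁻¹ * (R z * R z) * l := by rw [mul_inv_cancel₀ hl, mul_one, mul_assoc l⁻¹]
      _ = -1 := by rw [h.sq_right z hz, mul_neg_one, neg_mul, inv_mul_cancel₀ hl]
  · rw [hd z hz, hd z hz, h.left z hz, mul_assoc]
  · rw [hd z hz, hd z hz, h.right z hz, mul_assoc, mul_assoc, mul_inv_cancel_left₀ hl, neg_mul,
      mul_assoc]
  · rw [hd z hz]
    exact mul_ne_zero (h.fderiv_one_ne_zero z hz) hl

theorem rightDelbar_eq (h : ConformalOn Ω F N R) (hz : z ∈ Ω) {c : ℂ}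
    (hc : R z * (1 + quatJ * c) = -((1 + quatJ * c) * quatI)) :
    rightDelbar F z = -(rightDel F z * (quatJ * c)) := by
  have hF : fderiv ℝ F z I * (1 + quatJ * c) = fderiv ℝ F z 1 * ((1 + quatJ * c) * quatI) := by
    rw [h.right z hz, neg_mul, mul_assoc, hc, mul_neg, neg_neg]
  have hJ : quatI * (quatJ * c) = -(quatJ * c * quatI) := by
    rw [← mul_assoc, quatI_mul_quatJ, mul_assoc, coe_mul_quatI, neg_mul, mul_assoc]
  have key : fderiv ℝ F z 1 + fderiv ℝ F z I * quatI +
      (fderiv ℝ F z 1 - fderiv ℝ F z I * quatI) * (quatJ * c) =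
      fderiv ℝ F z 1 * (1 + quatJ * c) + fderiv ℝ F z I * (1 + quatJ * c) * quatI := by
    rw [sub_mul, mul_assoc (fderiv ℝ F z I) quatI, hJ]
    noncomm_ring
  rw [hF, mul_assoc _ (_ * quatI), mul_assoc _ quatI, quatI_mul_quatI, mul_neg_one, mul_neg,
    add_neg_cancel] at key
  rw [rightDelbar, rightDel, smul_mul_assoc, ← smul_neg, eq_neg_of_add_eq_zero_left key]

theorem mul_rightDel (h : ConformalOn Ω F N R) (hz : z ∈ Ω) :
    N z * rightDel F z = rightDel F z * quatI := by
  have hI : N z * fderiv ℝ F z I = -fderiv ℝ F z 1 := by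
    rw [h.left z hz, ← mul_assoc, h.sq_left z hz, neg_one_mul]
  rw [rightDel, mul_smul_comm, smul_mul_assoc, mul_sub, ← mul_assoc, hI, ← h.left z hz, sub_mul,
    mul_assoc _ quatI, quatI_mul_quatI]
  congr 1
  noncomm_ring

theorem rightDel_ne_zero (h : ConformalOn Ω F N R) (hz : z ∈ Ω)
    (h0 : complexFst (1 + R z * quatI) ≠ 0) : rightDel F z ≠ 0 := by
  intro h'
  rw [rightDel, smul_eq_zero, or_iff_right (by norm_num), h.right z hz] at h'
  have h1 : fderiv ℝ F z 1 * (1 + R z * quatI) = 0 := by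
    rw [← h']
    noncomm_ring
  exact h0 (by rw [(mul_eq_zero.1 h1).resolve_left (h.fderiv_one_ne_zero z hz), map_zero])

theorem contDiffOn_rightDel (h : ConformalOn Ω F N R) : ContDiffOn ℝ ∞ (rightDel F) Ω :=
  ((contDiffOn_fderiv_apply h.isOpen h.smooth 1).sub
    ((contDiffOn_fderiv_apply h.isOpen h.smooth I).mul contDiffOn_const)).const_smul _

theorem twistorCoordinates (h : ConformalOn Ω F N R)
    (h0 : ∀ z ∈ Ω, complexFst (1 + R z * quatI) ≠ 0) :
    TwistorCoordinates Ω (fun z => complexFst (F z)) (fun z => complexSnd (F z))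
      (fun z => stereographic (R z)) where
  isOpen := h.isOpen
  smooth_fst := complexFst.contDiff.comp_contDiffOn h.smooth
  smooth_snd := complexSnd.contDiff.comp_contDiffOn h.smooth
  smooth_normal := contDiffOn_stereographic h.smooth_right h0
  delbar_fst z hz := by
    have hF := h.differentiableAt h.smooth hz
    rw [← complexFst_rightDelbar hF, ← complexSnd_rightDel hF,
      h.rightDelbar_eq hz (mul_one_add_quatJ_mul_stereographic (h.sq_right z hz) (h0 z hz))]
    simp [complexFst_mul, complexSnd_mul, complexFst_coe, complexSnd_coe, complexFst_quatJ,
      complexSnd_quatJ, mul_comm]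
  delbar_snd z hz := by
    have hF := h.differentiableAt h.smooth hz
    rw [← complexSnd_rightDelbar hF, ← complexFst_rightDel hF,
      h.rightDelbar_eq hz (mul_one_add_quatJ_mul_stereographic (h.sq_right z hz) (h0 z hz))]
    simp [complexFst_mul, complexSnd_mul, complexFst_coe, complexSnd_coe, complexFst_quatJ,
      complexSnd_quatJ, mul_comm]
  immersion z hz := by
    have hF := h.differentiableAt h.smooth hz
    rw [← complexFst_rightDel hF, ← complexSnd_rightDel hF]
    exact fun h' => h.rightDel_ne_zero hz (h0 z hz) (ext_complex (by simp [h'.1]) (by simp [h'.2]))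

theorem fderiv_left_eq_iff (h : ConformalOn Ω F N R) (hz : z ∈ Ω)
    (h0 : complexFst (1 + R z * quatI) ≠ 0) :
    fderiv ℝ N z I = N z * fderiv ℝ N z 1 ↔
      osculatingMinor (fun z => complexFst (F z)) (fun z => complexSnd (F z)) z = 0 := by
  have mem := h.isOpen.eventually_mem hz
  have hfst : (fun w => complexFst (rightDel F w)) =ᶠ[𝓝 z] del fun w => complexFst (F w) :=
    mem.mono fun w hw => complexFst_rightDel (h.differentiableAt h.smooth hw)
  have hsnd : (fun w => complexSnd (rightDel F w)) =ᶠ[𝓝 z] del fun w => complexSnd (F w) :=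
    mem.mono fun w hw => complexSnd_rightDel (h.differentiableAt h.smooth hw)
  rw [fderiv_eq_mul_fderiv_iff_del (h.differentiableAt h.smooth_left hz)
    (h.differentiableAt h.contDiffOn_rightDel hz) (mem.mono h.sq_left) (h.rightDel_ne_zero hz h0)
    (mem.mono fun w => h.mul_rightDel), osculatingMinor, del_congr hfst, del_congr hsnd,
    hfst.eq_of_nhds, hsnd.eq_of_nhds]

theorem fderiv_right_eq_iff (h : ConformalOn Ω F N R)
    (h0 : ∀ z ∈ Ω, complexFst (1 + R z * quatI) ≠ 0) (hz : z ∈ Ω) :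
    fderiv ℝ R z I = R z * fderiv ℝ R z 1 ↔ delbar (fun z => stereographic (R z)) z = 0 := by
  have mem := h.isOpen.eventually_mem hz
  have hl : DifferentiableAt ℝ (fun w => 1 + quatJ * (stereographic (R w) : ℍ[ℝ])) z :=
    ((Quaternion.ofComplex.toLinearMap.toContinuousLinearMap.differentiableAt.comp z
      (h.differentiableAt (contDiffOn_stereographic h.smooth_right h0) hz)).const_mul _).const_add _
  have hl0 : 1 + quatJ * (stereographic (R z) : ℍ[ℝ]) ≠ 0 := fun h0 =>
    one_ne_zero ((complexFst_one_add_quatJ_mul _).symm.trans (by rw [h0, map_zero]))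
  rw [fderiv_eq_mul_fderiv_iff_delbar (h.differentiableAt h.smooth_right hz) hl
    (mem.mono h.sq_right) hl0 (mem.mono fun w hw =>
      mul_one_add_quatJ_mul_stereographic (h.sq_right w hw) (h0 w hw))]
  simp only [complexFst_one_add_quatJ_mul, complexSnd_one_add_quatJ_mul, one_mul]
  rw [delbar_const, zero_mul, sub_zero]

theorem exists_ball_complexFst_conj_ne_zero (h : ConformalOn Ω F N R) (hz₀ : z₀ ∈ Ω) :
    ∃ l ≠ 0, ∃ ε > 0, ball z₀ ε ⊆ Ω ∧
      ∀ z ∈ ball z₀ ε, complexFst (1 + l⁻¹ * R z * l * quatI) ≠ 0 := by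
  obtain ⟨l, hl, hRl⟩ := exists_mul_eq_neg_mul_quatI (h.sq_right z₀ hz₀)
  have hz₀_ne : complexFst (1 + l⁻¹ * R z₀ * l * quatI) ≠ 0 := by
    rw [mul_assoc l⁻¹, hRl, mul_neg, inv_mul_cancel_left₀ hl, neg_mul, quatI_mul_quatI, neg_neg,
      map_add, complexFst_one]
    norm_num
  have hcont : ContinuousAt (fun z => complexFst (1 + l⁻¹ * R z * l * quatI)) z₀ :=
    complexFst.continuous.continuousAt.comp (continuousAt_const.add
      (((continuousAt_const.mul (h.differentiableAt h.smooth_right hz₀).continuousAt).mul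
        continuousAt_const).mul continuousAt_const))
  obtain ⟨ε, hε, hball⟩ := Metric.mem_nhds_iff.1
    ((h.isOpen.eventually_mem hz₀).and (hcont.eventually_ne hz₀_ne))
  exact ⟨l, hl, ε, hε, fun z hz => (hball hz).1, fun z hz => (hball hz).2⟩

theorem exists_ball_forall_fderiv_left_eq (h : ConformalOn Ω F N R)
    (hdich : ∀ z ∈ Ω, fderiv ℝ R z I = R z * fderiv ℝ R z 1 ∨
      fderiv ℝ N z I = N z * fderiv ℝ N z 1) (hz₀ : z₀ ∈ Ω) :
    ∃ ε > 0, ball z₀ ε ⊆ Ω ∧ ∀ z₁ ∈ ball z₀ ε,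
      (∀ᶠ z in 𝓝 z₁, fderiv ℝ N z I = N z * fderiv ℝ N z 1) →
      ∀ z ∈ ball z₀ ε, fderiv ℝ N z I = N z * fderiv ℝ N z 1 := by
  obtain ⟨l, hl, ε, hε, hball, h0⟩ := h.exists_ball_complexFst_conj_ne_zero hz₀
  have hB := (h.mul_const hl).mono isOpen_ball hball
  refine ⟨ε, hε, hball, fun z₁ hz₁ hN z hz => ?_⟩
  rw [hB.fderiv_left_eq_iff hz (h0 z hz)]
  refine (hB.twistorCoordinates h0).osculatingMinor_eqOn_zero (convex_ball z₀ ε).isPreconnected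
    (fun w hw => ?_) hz₁ ?_ hz
  · rw [← hB.fderiv_right_eq_iff h0 hw, ← hB.fderiv_left_eq_iff hw (h0 w hw)]
    exact (hdich w (hball hw)).imp_left
      (fderiv_conj_eq_mul (h.differentiableAt h.smooth_right (hball hw)) hl)
  · filter_upwards [hN, isOpen_ball.mem_nhds hz₁] with w hw hwB
    exact (hB.fderiv_left_eq_iff hwB (h0 w hwB)).1 hw

end ConformalOn

end PlanarDomain

/-! ### Circles among ellipses -/

section Ellipse

variable {V : Type*} [NormedAddCommGroup V] [InnerProductSpace ℝ V] {d m u v : V} {r s : ℝ}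

theorem norm_re_smul_add_im_smul_sq (u v : V) (w : ℂ) :
    ‖w.re • u + w.im • v‖ ^ 2 =
      w.re ^ 2 * ‖u‖ ^ 2 + 2 * (w.re * w.im) * ⟪u, v⟫ + w.im ^ 2 * ‖v‖ ^ 2 := by
  rw [norm_add_sq_real, real_inner_smul_left, real_inner_smul_right, norm_smul, norm_smul, mul_pow,
    mul_pow, Real.norm_eq_abs, Real.norm_eq_abs, sq_abs, sq_abs]
  ring

theorem norm_re_smul_add_im_smul (huv : ‖u‖ = ‖v‖) (h : ⟪u, v⟫ = 0) (w : ℂ) :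
    ‖w.re • u + w.im • v‖ = ‖w‖ * ‖u‖ := by
  rw [← sq_eq_sq₀ (norm_nonneg _) (by positivity), norm_re_smul_add_im_smul_sq, h, ← huv, mul_pow,
    Complex.sq_norm, Complex.normSq_apply]
  ring

theorem norm_eq_and_inner_eq_zero_of_norm_const (hs : 0 < s)
    (h : ∀ w : ℂ, ‖w‖ = s → ‖d + (w.re • u + w.im • v)‖ = r) : ‖u‖ = ‖v‖ ∧ ⟪u, v⟫ = 0 := by
  -- The parallelogram law for `w` and `-w` removes the centre `d`.
  have hconst (w : ℂ) (hw : ‖w‖ = 1) : s ^ 2 * (w.re ^ 2 * ‖u‖ ^ 2 +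
      2 * (w.re * w.im) * ⟪u, v⟫ + w.im ^ 2 * ‖v‖ ^ 2) = r ^ 2 - ‖d‖ ^ 2 := by
    have hsw : ‖(s : ℂ) * w‖ = s := by simp [hw, abs_of_pos hs]
    have hpos := h (s * w) hsw
    have hneg := h (-(s * w)) (by rw [norm_neg, hsw])
    have hpar := parallelogram_law_with_norm ℝ d (s • (w.re • u + w.im • v))
    simp only [neg_re, neg_im, re_ofReal_mul, im_ofReal_mul, neg_smul, mul_smul] at hpos hneg
    rw [← smul_add] at hpos
    rw [← neg_add, ← smul_add, ← sub_eq_add_neg] at hneg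
    rw [hpos, hneg, norm_smul, Real.norm_of_nonneg hs.le] at hpar
    rw [← norm_re_smul_add_im_smul_sq]
    linarith
  have hu := hconst 1 (by simp)
  have hv := hconst I (by simp)
  have huv := hconst ⟨3 / 5, 4 / 5⟩ (by
    rw [Complex.norm_def, Complex.normSq_mk, Real.sqrt_eq_one]
    norm_num)
  simp only [one_re, one_im, I_re, I_im] at hu hv
  have hs2 : s ^ 2 ≠ 0 := by positivity
  have hnorm : ‖u‖ ^ 2 = ‖v‖ ^ 2 := mul_left_cancel₀ hs2 (by linarith)
  refine ⟨(sq_eq_sq₀ (norm_nonneg _) (norm_nonneg _)).1 hnorm, mul_left_cancel₀ hs2 ?_⟩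
  rw [← hnorm] at huv
  linarith

theorem exists_norm_eq_and_re_smul_add_im_smul_eq {W : Submodule ℝ V} (hW : Module.finrank ℝ W = 2)
    (hu : u ∈ W) (hv : v ∈ W) (huv : ‖u‖ = ‖v‖) (horth : ⟪u, v⟫ = 0) (hs : 0 ≤ s) {x : V}
    (hx : x ∈ W) (hxs : ‖x‖ = s * ‖u‖) : ∃ w : ℂ, ‖w‖ = s ∧ w.re • u + w.im • v = x := by
  rcases eq_or_ne u 0 with rfl | hu0
  · refine ⟨s, by simp [abs_of_nonneg hs], ?_⟩
    rw [norm_zero, eq_comm, norm_eq_zero] at huv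
    rw [norm_zero, mul_zero, norm_eq_zero] at hxs
    simp [huv, hxs]
  have hunorm : ‖u‖ ≠ 0 := norm_ne_zero_iff.2 hu0
  have hv0 : v ≠ 0 := norm_ne_zero_iff.1 (huv ▸ hunorm)
  have hspan : Submodule.span ℝ {u, v} = W := by
    have : FiniteDimensional ℝ W := Module.finite_of_finrank_eq_succ hW
    have hli : LinearIndependent ℝ ![u, v] :=
      linearIndependent_of_ne_zero_of_inner_eq_zero (by simp [Fin.forall_fin_two, hu0, hv0])
        (by simp [Pairwise, Fin.forall_fin_two, horth, real_inner_comm])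
    refine Submodule.eq_of_le_of_finrank_eq (Submodule.span_le.2 ?_) ?_
    · simp [Set.insert_subset_iff, hu, hv]
    · rw [hW, ← Matrix.range_cons_cons_empty, finrank_span_eq_card hli, Fintype.card_fin]
  obtain ⟨a, b, rfl⟩ := Submodule.mem_span_pair.1 (hspan ▸ hx)
  refine ⟨⟨a, b⟩, mul_right_cancel₀ hunorm ?_, rfl⟩
  rw [← norm_re_smul_add_im_smul huv horth, ← hxs]

theorem ellipse_eq_circle_iff {W : Submodule ℝ V} (hW : Module.finrank ℝ W = 2) (hm : m ∈ W)
    (hu : u ∈ W) (hv : v ∈ W) (hs : 0 < s) :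
    (∃ c ∈ W, ∃ r : ℝ, 0 ≤ r ∧
      {x | ∃ w : ℂ, ‖w‖ = s ∧ x = m + (w.re • u + w.im • v)} = {x | x ∈ W ∧ ‖x - c‖ = r}) ↔
      ‖u‖ = ‖v‖ ∧ ⟪u, v⟫ = 0 := by
  constructor
  · rintro ⟨c, -, r, -, h⟩
    refine norm_eq_and_inner_eq_zero_of_norm_const (d := m - c) (r := r) hs fun w hw => ?_
    rw [sub_add_eq_add_sub]
    exact (h.subset ⟨w, hw, rfl⟩).2
  · rintro ⟨huv, horth⟩
    refine ⟨m, hm, s * ‖u‖, by positivity, Set.Subset.antisymm ?_ ?_⟩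
    · rintro _ ⟨w, hw, rfl⟩
      refine ⟨W.add_mem hm (W.add_mem (W.smul_mem _ hu) (W.smul_mem _ hv)), ?_⟩
      rw [add_sub_cancel_left, norm_re_smul_add_im_smul huv horth, hw]
    · rintro x ⟨hx, hxm⟩
      obtain ⟨w, hw, hwx⟩ := exists_norm_eq_and_re_smul_add_im_smul_eq hW hu hv huv horth hs.le
        (W.sub_mem hx hm) hxm
      exact ⟨w, hw, by rw [hwx, add_sub_cancel]⟩

end Ellipse

/-! ### Normal planes of conformal maps -/

section SquareRoots

variable {K : ℍ[ℝ]}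

theorem mul_self_eq_neg_one_iff : K * K = -1 ↔ ‖K‖ = 1 ∧ K.re = 0 := by
  have hnormSq : ‖K‖ = 1 → ((Quaternion.normSq K : ℝ) : ℍ[ℝ]) = 1 := fun h => by
    rw [Quaternion.normSq_eq_norm_mul_self, h, mul_one, Quaternion.coe_one]
  constructor
  · intro h
    have hnorm : ‖K‖ = 1 := by
      rw [← pow_eq_one_iff_of_nonneg (norm_nonneg K) two_ne_zero, sq, ← norm_mul, h, norm_neg,
        norm_one]
    exact ⟨hnorm, Quaternion.sq_eq_neg_normSq.1 (by rw [sq, h, hnormSq hnorm])⟩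
  · rintro ⟨hnorm, hre⟩
    rw [← sq, Quaternion.sq_eq_neg_normSq.2 hre, hnormSq hnorm]

theorem star_eq_neg_of_mul_self (hK : K * K = -1) : star K = -K :=
  Quaternion.star_eq_neg.2 (mul_self_eq_neg_one_iff.1 hK).2

theorem exists_eq_add_smul_of_commute {q : ℍ[ℝ]} (hK : K * K = -1) (h : Commute q K) :
    ∃ a b : ℝ, q = a + b • K := by
  have hre := (mul_self_eq_neg_one_iff.1 hK).2
  set p : ℍ[ℝ] := q - (q.re + (-(q * K).re) • K)
  have hpK : Commute p K :=
    h.sub_left (.add_left (Quaternion.coe_commutes _ _) ((Commute.refl K).smul_left _))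
  have hp : star p = -p := Quaternion.star_eq_neg.2 (by simp [p, hre])
  have hpK_star : star (p * K) = -(p * K) := by
    refine Quaternion.star_eq_neg.2 ?_
    simp only [p, sub_mul, add_mul, smul_mul_assoc, hK]
    simp [hre]
  have hzero : p * K = 0 := by
    rw [star_mul, hp, star_eq_neg_of_mul_self hK, neg_mul_neg, ← hpK.eq] at hpK_star
    rwa [eq_neg_iff_add_eq_zero, ← two_smul ℝ, smul_eq_zero_iff_right two_ne_zero] at hpK_star
  have hK0 : K ≠ 0 := fun h0 => by simp [h0] at hK
  exact ⟨q.re, -(q * K).re, sub_eq_zero.1 ((mul_eq_zero.1 hzero).resolve_right hK0)⟩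

theorem commute_mul_inv {N R u v : ℍ[ℝ]} (hu : N * u = u * R) (hv : N * v = v * R) :
    Commute (v * u⁻¹) N :=
  SemiconjBy.mul_left (y := R) hv.symm (SemiconjBy.inv_symm_left₀ hu.symm)

theorem inner_mul_left_mul_left (hK : ‖K‖ = 1) (a b : ℍ[ℝ]) : ⟪K * a, K * b⟫ = ⟪a, b⟫ := by
  simp only [real_inner_eq_norm_add_mul_self_sub_norm_mul_self_sub_norm_mul_self_div_two,
    ← mul_add, norm_mul, hK, one_mul]

theorem inner_mul_right_mul_right (hK : ‖K‖ = 1) (a b : ℍ[ℝ]) : ⟪a * K, b * K⟫ = ⟪a, b⟫ := by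
  simp only [real_inner_eq_norm_add_mul_self_sub_norm_mul_self_sub_norm_mul_self_div_two,
    ← add_mul, norm_mul, hK, mul_one]

theorem inner_self_mul_left (hK : K * K = -1) (a : ℍ[ℝ]) : ⟪a, K * a⟫ = 0 := by
  have h := inner_mul_left_mul_left (mul_self_eq_neg_one_iff.1 hK).1 a (K * a)
  rw [← mul_assoc, hK, neg_one_mul, inner_neg_right, real_inner_comm] at h
  linarith

theorem norm_eq_and_inner_eq_zero_iff {N R u v : ℍ[ℝ]} (hN : N * N = -1) (hu : N * u = u * R)
    (hv : N * v = v * R) : ‖u‖ = ‖v‖ ∧ ⟪u, v⟫ = 0 ↔ v = N * u ∨ v = -(N * u) := by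
  have hNnorm := (mul_self_eq_neg_one_iff.1 hN).1
  constructor
  · rintro ⟨hnorm, horth⟩
    rcases eq_or_ne u 0 with rfl | hu0
    · rw [norm_zero, eq_comm, norm_eq_zero] at hnorm
      simp [hnorm]
    have hsq : v * u⁻¹ * (v * u⁻¹) = -1 := by
      rw [mul_self_eq_neg_one_iff, norm_mul, norm_inv, ← hnorm,
        mul_inv_cancel₀ (norm_ne_zero_iff.2 hu0), Quaternion.inv_def, mul_smul_comm,
        Quaternion.re_smul, ← Quaternion.inner_def, real_inner_comm, horth, smul_zero]
      exact ⟨rfl, rfl⟩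
    -- Commuting square roots of `-1` agree up to sign.
    have hcomm := commute_mul_inv hu hv
    rw [← neg_mul, ← mul_inv_eq_iff_eq_mul₀ hu0, ← mul_inv_eq_iff_eq_mul₀ hu0]
    exact hcomm.mul_self_eq_mul_self_iff.1 (hsq.trans hN.symm)
  · rintro (rfl | rfl)
    · exact ⟨by rw [norm_mul, hNnorm, one_mul], inner_self_mul_left hN u⟩
    · exact ⟨by rw [norm_neg, norm_mul, hNnorm, one_mul],
        by rw [inner_neg_right, inner_self_mul_left hN, neg_zero]⟩

end SquareRoots

section ConformalLinear

variable {L : ℂ →L[ℝ] ℍ[ℝ]} {N R n y : ℍ[ℝ]} {X : ℂ}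

/-- `L : ℂ → ℍ` is a conformal injection whose image has left normal vector `N` and right normal
vector `R`; it is the differential of a conformal immersion at a point. -/
structure IsConformalLinear (L : ℂ →L[ℝ] ℍ[ℝ]) (N R : ℍ[ℝ]) : Prop where
  sq_left : N * N = -1
  sq_right : R * R = -1
  left : L I = N * L 1
  right : L I = -(L 1 * R)
  ne_zero : L 1 ≠ 0

namespace IsConformalLinear

theorem apply_eq_re_smul_add_im_smul (h : IsConformalLinear L N R) (X : ℂ) :
    L X = X.re • L 1 + X.im • (N * L 1) := by
  conv_lhs => rw [← re_add_im X, ← mul_one (X.re : ℂ), ← real_smul, ← real_smul, map_add, map_smul,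
    map_smul, h.left]

theorem norm_apply (h : IsConformalLinear L N R) (X : ℂ) : ‖L X‖ = ‖X‖ * ‖L 1‖ := by
  rw [h.apply_eq_re_smul_add_im_smul]
  refine norm_re_smul_add_im_smul ?_ (inner_self_mul_left h.sq_left _) X
  rw [norm_mul, (mul_self_eq_neg_one_iff.1 h.sq_left).1, one_mul]

theorem injective (h : IsConformalLinear L N R) : Function.Injective L := by
  refine (injective_iff_map_eq_zero L).2 fun X hX => ?_
  rwa [← norm_eq_zero, h.norm_apply, mul_eq_zero, or_iff_left (norm_ne_zero_iff.2 h.ne_zero),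
    norm_eq_zero] at hX

theorem finrank_orthogonal_range (h : IsConformalLinear L N R) :
    Module.finrank ℝ ↥(LinearMap.range L.toLinearMap)ᗮ = 2 := by
  have hsum := Submodule.finrank_add_finrank_orthogonal (LinearMap.range L.toLinearMap)
  rw [LinearMap.finrank_range_of_inj h.injective, finrank_real_complex,
    Quaternion.finrank_eq_four] at hsum
  lia

theorem mul_one_eq (h : IsConformalLinear L N R) : N * L 1 = L 1 * -R := by
  rw [← h.left, h.right, mul_neg]

theorem mem_range_iff (h : IsConformalLinear L N R) :
    y ∈ LinearMap.range L.toLinearMap ↔ N * y = -(y * R) := by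
  constructor
  · rintro ⟨X, rfl⟩
    change N * L X = -(L X * R)
    rw [h.apply_eq_re_smul_add_im_smul, mul_add, add_mul, mul_smul_comm, mul_smul_comm,
      smul_mul_assoc, smul_mul_assoc, h.mul_one_eq, ← mul_assoc, h.mul_one_eq]
    simp only [mul_neg, neg_mul, smul_neg, neg_add]
  · intro hy
    obtain ⟨a, b, hab⟩ := exists_eq_add_smul_of_commute h.sq_left
      (commute_mul_inv h.mul_one_eq (hy.trans (mul_neg _ _).symm))
    refine ⟨⟨a, b⟩, ?_⟩
    change L _ = y
    rw [h.apply_eq_re_smul_add_im_smul, ← inv_mul_cancel_right₀ h.ne_zero y, hab, add_mul,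
      smul_mul_assoc, Quaternion.coe_mul_eq_smul]

theorem mem_orthogonal_range (h : IsConformalLinear L N R) (hn : N * n = n * R) :
    n ∈ (LinearMap.range L.toLinearMap)ᗮ := by
  refine (Submodule.mem_orthogonal _ _).2 fun y hy => ?_
  have hyn : ⟪N * y, N * n⟫ = -⟪y, n⟫ := by
    rw [h.mem_range_iff.1 hy, hn, inner_neg_left,
      inner_mul_right_mul_right (mul_self_eq_neg_one_iff.1 h.sq_right).1]
  rw [inner_mul_left_mul_left (mul_self_eq_neg_one_iff.1 h.sq_left).1] at hyn
  linarith

theorem starProjection_orthogonal_range (h : IsConformalLinear L N R) (n : ℍ[ℝ]) :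
    (LinearMap.range L.toLinearMap)ᗮ.starProjection n = (2 : ℝ)⁻¹ • (n - N * n * R) := by
  have hRR (x : ℍ[ℝ]) : x * R * R = -x := by rw [mul_assoc, h.sq_right, mul_neg_one]
  have hNN (x : ℍ[ℝ]) : N * (N * x) = -x := by rw [← mul_assoc, h.sq_left, neg_one_mul]
  refine Submodule.eq_starProjection_of_mem_orthogonal' (z := (2 : ℝ)⁻¹ • (n + N * n * R)) ?_ ?_ ?_
  · refine h.mem_orthogonal_range ?_
    rw [mul_smul_comm, smul_mul_assoc, mul_sub, sub_mul, hRR, mul_assoc N n, hNN, sub_neg_eq_add,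
      sub_neg_eq_add, add_comm]
  · refine Submodule.le_orthogonal_orthogonal _ (h.mem_range_iff.2 ?_)
    rw [mul_smul_comm, smul_mul_assoc, ← smul_neg, mul_add, add_mul, hRR, mul_assoc N n, hNN,
      neg_add_rev, neg_neg]
  · module

theorem mem_orthogonal_range_iff (h : IsConformalLinear L N R) :
    n ∈ (LinearMap.range L.toLinearMap)ᗮ ↔ N * n = n * R := by
  refine ⟨fun hn => ?_, h.mem_orthogonal_range⟩
  have hP := Submodule.starProjection_eq_self_iff.2 hn
  rw [h.starProjection_orthogonal_range, inv_smul_eq_iff₀ two_ne_zero, two_smul, sub_eq_add_neg,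
    add_right_inj] at hP
  conv_rhs => rw [← hP]
  rw [neg_mul, mul_assoc _ R, h.sq_right, mul_neg_one, neg_neg]

theorem starProjection_mul_left (h : IsConformalLinear L N R) (n : ℍ[ℝ]) :
    (LinearMap.range L.toLinearMap)ᗮ.starProjection (N * n) =
      N * (LinearMap.range L.toLinearMap)ᗮ.starProjection n := by
  rw [h.starProjection_orthogonal_range, h.starProjection_orthogonal_range, mul_smul_comm, mul_sub,
    mul_assoc N (N * n)]

theorem starProjection_mul_right (h : IsConformalLinear L N R) (n : ℍ[ℝ]) :
    (LinearMap.range L.toLinearMap)ᗮ.starProjection (n * R) =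
      (LinearMap.range L.toLinearMap)ᗮ.starProjection n * R := by
  rw [h.starProjection_orthogonal_range, h.starProjection_orthogonal_range, smul_mul_assoc, sub_mul,
    mul_assoc N n]

theorem exists_quadratic_eq_iff (h : IsConformalLinear L N R) (P : ℍ[ℝ] →L[ℝ] ℍ[ℝ])
    (a b c x : ℍ[ℝ]) :
    (∃ X : ℂ, ‖L X‖ = 1 ∧ x = P (X.re ^ 2 • a + (2 * (X.re * X.im)) • b + X.im ^ 2 • c)) ↔
      ∃ w : ℂ, ‖w‖ = (‖L 1‖ ^ 2)⁻¹ ∧ x = P ((‖L 1‖ ^ 2)⁻¹ • (2 : ℝ)⁻¹ • (a + c)) +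
        (w.re • P ((2 : ℝ)⁻¹ • (a - c)) + w.im • P b) := by
  have hnorm (X : ℂ) : ‖L X‖ = 1 ↔ ‖X ^ 2‖ = (‖L 1‖ ^ 2)⁻¹ := by
    have hL1 : ‖L 1‖ ≠ 0 := norm_ne_zero_iff.2 h.ne_zero
    rw [h.norm_apply, mul_eq_one_iff_eq_inv₀ hL1, norm_pow, ← inv_pow,
      sq_eq_sq₀ (norm_nonneg _) (by positivity)]
  have hquad (X : ℂ) (hX : ‖L X‖ = 1) :
      P (X.re ^ 2 • a + (2 * (X.re * X.im)) • b + X.im ^ 2 • c) =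
        P ((‖L 1‖ ^ 2)⁻¹ • (2 : ℝ)⁻¹ • (a + c)) +
          ((X ^ 2).re • P ((2 : ℝ)⁻¹ • (a - c)) + (X ^ 2).im • P b) := by
    rw [← (hnorm X).1 hX, ← map_smul, ← map_smul, ← map_add, ← map_add, norm_pow, Complex.sq_norm,
      Complex.normSq_apply, sq X, mul_re, mul_im]
    congr 1
    module
  constructor
  · rintro ⟨X, hX, rfl⟩
    exact ⟨X ^ 2, (hnorm X).1 hX, hquad X hX⟩
  · rintro ⟨w, hw, rfl⟩
    obtain ⟨X, rfl⟩ := IsAlgClosed.exists_pow_nat_eq w two_pos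
    exact ⟨X, (hnorm X).2 hw, (hquad X ((hnorm X).2 hw)).symm⟩

theorem exists_eq_circle_iff (h : IsConformalLinear L N R) (a b c : ℍ[ℝ]) :
    (∃ x₀ ∈ (LinearMap.range L.toLinearMap)ᗮ, ∃ r : ℝ, 0 ≤ r ∧
        {x | ∃ X : ℂ, ‖L X‖ = 1 ∧ x = (LinearMap.range L.toLinearMap)ᗮ.starProjection
          (X.re ^ 2 • a + (2 * (X.re * X.im)) • b + X.im ^ 2 • c)} =
          {x | x ∈ (LinearMap.range L.toLinearMap)ᗮ ∧ ‖x - x₀‖ = r}) ↔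
      (LinearMap.range L.toLinearMap)ᗮ.starProjection ((2 : ℝ) • b - N * (a - c)) = 0 ∨
        (LinearMap.range L.toLinearMap)ᗮ.starProjection ((2 : ℝ) • b + (a - c) * R) = 0 := by
  have hmem (n : ℍ[ℝ]) := Submodule.starProjection_apply_mem (LinearMap.range L.toLinearMap)ᗮ n
  have hL1 : 0 < (‖L 1‖ ^ 2)⁻¹ := inv_pos.2 (pow_pos (norm_pos_iff.2 h.ne_zero) 2)
  simp_rw [h.exists_quadratic_eq_iff]
  rw [ellipse_eq_circle_iff h.finrank_orthogonal_range (hmem _) (hmem _) (hmem _) hL1,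
    norm_eq_and_inner_eq_zero_iff h.sq_left (h.mem_orthogonal_range_iff.1 (hmem _))
      (h.mem_orthogonal_range_iff.1 (hmem _)), map_sub, map_add, map_smul, map_smul,
    h.starProjection_mul_left, h.starProjection_mul_right,
    ← h.mem_orthogonal_range_iff.1 (hmem (a - c)), mul_smul_comm]
  rw [eq_inv_smul_iff₀ two_ne_zero, ← smul_neg, eq_inv_smul_iff₀ two_ne_zero, sub_eq_zero,
    add_eq_zero_iff_eq_neg]

end IsConformalLinear

end ConformalLinear

/-! ### The curvature ellipse in a planar domain -/

theorem add_mul_eq_zero_iff {K p q : ℍ[ℝ]} (hK : K * K = -1) : p + K * q = 0 ↔ q = K * p := by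
  have hfactor : q - K * p = -(K * (p + K * q)) := by
    rw [mul_add, ← mul_assoc, hK]
    noncomm_ring
  have hK0 : K ≠ 0 := fun h0 => by simp [h0] at hK
  rw [← sub_eq_zero (a := q), hfactor, neg_eq_zero, mul_eq_zero, or_iff_right hK0]

namespace ConformalOn

variable {Ω : Set ℂ} {F N R : ℂ → ℍ[ℝ]} {z : ℂ}

theorem isConformalLinear (h : ConformalOn Ω F N R) (hz : z ∈ Ω) :
    IsConformalLinear (fderiv ℝ F z) (N z) (R z) :=
  ⟨h.sq_left z hz, h.sq_right z hz, h.left z hz, h.right z hz, h.fderiv_one_ne_zero z hz⟩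

theorem fderiv_fderiv_self (h : ConformalOn Ω F N R) (hz : z ∈ Ω) (X : ℂ) :
    fderiv ℝ (fun w => fderiv ℝ F w X) z X =
      X.re ^ 2 • fderiv ℝ (fun w => fderiv ℝ F w 1) z 1 +
        (2 * (X.re * X.im)) • fderiv ℝ (fun w => fderiv ℝ F w I) z 1 +
        X.im ^ 2 • fderiv ℝ (fun w => fderiv ℝ F w I) z I := by
  have hX : X = X.re • (1 : ℂ) + X.im • I := by simp [re_add_im]
  have hcomm := fderiv_fderiv_apply_comm h.isOpen h.smooth hz I 1
  simp only [fderiv_fderiv_apply h.isOpen h.smooth hz] at hcomm ⊢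
  conv_lhs => rw [hX]
  simp only [map_add, map_smul, add_apply, smul_apply, hcomm]
  module

theorem fderiv_fderiv_I_left (h : ConformalOn Ω F N R) (hz : z ∈ Ω) (X : ℂ) :
    fderiv ℝ (fun w => fderiv ℝ F w I) z X =
      fderiv ℝ N z X * fderiv ℝ F z 1 + N z * fderiv ℝ (fun w => fderiv ℝ F w 1) z X := by
  have hF := h.differentiableAt (contDiffOn_fderiv_apply h.isOpen h.smooth 1) hz
  have hN := h.differentiableAt h.smooth_left hz
  rw [Filter.EventuallyEq.fderiv_eq (h.isOpen.eventually_mem hz |>.mono h.left),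
    fderiv_fun_mul' hN hF]
  simp [add_comm]

theorem fderiv_fderiv_I_right (h : ConformalOn Ω F N R) (hz : z ∈ Ω) (X : ℂ) :
    fderiv ℝ (fun w => fderiv ℝ F w I) z X =
      -(fderiv ℝ (fun w => fderiv ℝ F w 1) z X * R z + fderiv ℝ F z 1 * fderiv ℝ R z X) := by
  have hF := h.differentiableAt (contDiffOn_fderiv_apply h.isOpen h.smooth 1) hz
  have hR := h.differentiableAt h.smooth_right hz
  rw [Filter.EventuallyEq.fderiv_eq (h.isOpen.eventually_mem hz |>.mono h.right),
    fderiv_fun_neg, fderiv_fun_mul' hF hR]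
  simp [add_comm]

theorem starProjection_left_eq_zero_iff (h : ConformalOn Ω F N R) (hz : z ∈ Ω) :
    (LinearMap.range (fderiv ℝ F z).toLinearMap)ᗮ.starProjection
        ((2 : ℝ) • fderiv ℝ (fun w => fderiv ℝ F w I) z 1 - N z *
          (fderiv ℝ (fun w => fderiv ℝ F w 1) z 1 - fderiv ℝ (fun w => fderiv ℝ F w I) z I)) = 0 ↔
      fderiv ℝ N z I = N z * fderiv ℝ N z 1 := by
  have hL := h.isConformalLinear hz
  have hvector : (2 : ℝ) • fderiv ℝ (fun w => fderiv ℝ F w I) z 1 - N z *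
      (fderiv ℝ (fun w => fderiv ℝ F w 1) z 1 - fderiv ℝ (fun w => fderiv ℝ F w I) z I) =
      (fderiv ℝ N z 1 + N z * fderiv ℝ N z I) * fderiv ℝ F z 1 := by
    have hx := h.fderiv_fderiv_I_left hz 1
    have hy := h.fderiv_fderiv_I_left hz I
    rw [← fderiv_fderiv_apply_comm h.isOpen h.smooth hz 1 I] at hy
    rw [hy, two_smul, mul_sub, mul_add, ← mul_assoc (N z) (N z), h.sq_left z hz, hx]
    noncomm_ring
  have hmem : (fderiv ℝ N z 1 + N z * fderiv ℝ N z I) * fderiv ℝ F z 1 ∈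
      (LinearMap.range (fderiv ℝ F z).toLinearMap)ᗮ := by
    have anticomm := fderiv_mul_self_anticomm (h.differentiableAt h.smooth_left hz)
      (h.isOpen.eventually_mem hz |>.mono h.sq_left)
    refine hL.mem_orthogonal_range ?_
    rw [mul_assoc _ _ (R z), ← neg_eq_iff_eq_neg.2 hL.right, hL.left, mul_neg, ← mul_assoc,
      ← mul_assoc, ← neg_mul, add_mul, mul_assoc (N z) _ (N z), anticomm, anticomm]
    noncomm_ring
  rw [hvector, Submodule.starProjection_eq_self_iff.2 hmem, mul_eq_zero, or_iff_left hL.ne_zero,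
    add_mul_eq_zero_iff (h.sq_left z hz)]

theorem starProjection_right_eq_zero_iff (h : ConformalOn Ω F N R) (hz : z ∈ Ω) :
    (LinearMap.range (fderiv ℝ F z).toLinearMap)ᗮ.starProjection
        ((2 : ℝ) • fderiv ℝ (fun w => fderiv ℝ F w I) z 1 +
          (fderiv ℝ (fun w => fderiv ℝ F w 1) z 1 - fderiv ℝ (fun w => fderiv ℝ F w I) z I) *
            R z) = 0 ↔
      fderiv ℝ R z I = R z * fderiv ℝ R z 1 := by
  have hL := h.isConformalLinear hz
  have anticomm := fderiv_mul_self_anticomm (h.differentiableAt h.smooth_right hz)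
    (h.isOpen.eventually_mem hz |>.mono h.sq_right)
  have hvector : (2 : ℝ) • fderiv ℝ (fun w => fderiv ℝ F w I) z 1 +
      (fderiv ℝ (fun w => fderiv ℝ F w 1) z 1 - fderiv ℝ (fun w => fderiv ℝ F w I) z I) * R z =
      -(fderiv ℝ F z 1 * (fderiv ℝ R z 1 + R z * fderiv ℝ R z I)) := by
    have hx := h.fderiv_fderiv_I_right hz 1
    have hy := h.fderiv_fderiv_I_right hz I
    rw [← fderiv_fderiv_apply_comm h.isOpen h.smooth hz 1 I] at hy
    rw [hy, two_smul, sub_mul, neg_mul, add_mul, mul_assoc _ (R z) (R z), h.sq_right z hz,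
      mul_assoc (fderiv ℝ F z 1), anticomm, hx]
    noncomm_ring
  have hmem : -(fderiv ℝ F z 1 * (fderiv ℝ R z 1 + R z * fderiv ℝ R z I)) ∈
      (LinearMap.range (fderiv ℝ F z).toLinearMap)ᗮ := by
    refine hL.mem_orthogonal_range ?_
    rw [mul_neg, ← mul_assoc, ← hL.left, hL.right, neg_mul, neg_mul,
      mul_assoc (fderiv ℝ F z 1), mul_assoc (fderiv ℝ F z 1), add_mul, mul_assoc (R z) _ (R z),
      anticomm, anticomm]
    noncomm_ring
  rw [hvector, Submodule.starProjection_eq_self_iff.2 hmem, neg_eq_zero, mul_eq_zero,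
    or_iff_right hL.ne_zero, add_mul_eq_zero_iff (h.sq_right z hz)]

theorem curvatureEllipse_eq_circle_iff (h : ConformalOn Ω F N R) (hz : z ∈ Ω) :
    (∃ c ∈ (LinearMap.range (fderiv ℝ F z).toLinearMap)ᗮ, ∃ r : ℝ, 0 ≤ r ∧
        {v | ∃ X : ℂ, ‖fderiv ℝ F z X‖ = 1 ∧
          v = (LinearMap.range (fderiv ℝ F z).toLinearMap)ᗮ.starProjection
            (fderiv ℝ (fun w => fderiv ℝ F w X) z X)} =
          {v | v ∈ (LinearMap.range (fderiv ℝ F z).toLinearMap)ᗮ ∧ ‖v - c‖ = r}) ↔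
      fderiv ℝ N z I = N z * fderiv ℝ N z 1 ∨ fderiv ℝ R z I = R z * fderiv ℝ R z 1 := by
  rw [← h.starProjection_left_eq_zero_iff hz, ← h.starProjection_right_eq_zero_iff hz,
    ← (h.isConformalLinear hz).exists_eq_circle_iff]
  simp only [← h.fderiv_fderiv_self hz]

end ConformalOn

/-! ### Differentials in charts of a Riemann surface -/

section Charts

variable {M : Type*} [TopologicalSpace M] [ChartedSpace ℂ M]
  {F : Type*} [NormedAddCommGroup F] [NormedSpace ℝ F] {g : M → F} {p q : M}

theorem contDiffOn_transition [IsManifold 𝓘(ℂ) ω M] {e e' : OpenPartialHomeomorph M ℂ}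
    (he : e ∈ atlas ℂ M) (he' : e' ∈ atlas ℂ M) :
    ContDiffOn ℂ ω (e.symm ≫ₕ e') (e.symm ≫ₕ e').source :=
  (contMDiffOn_of_mem_contDiffGroupoid
    ((contDiffGroupoid ω 𝓘(ℂ)).compatible he he')).contDiffOn

theorem isManifold_real [IsManifold 𝓘(ℂ) ω M] : IsManifold 𝓘(ℝ, ℂ) ∞ M := by
  refine isManifold_of_contDiffOn _ _ _ fun e e' he he' => ?_
  simpa using ((contDiffOn_transition he he').restrict_scalars ℝ).of_le (m := ∞) le_top

theorem contDiffOn_comp_chart_symm [IsManifold 𝓘(ℂ) ω M] (hg : ContMDiff 𝓘(ℝ, ℂ) 𝓘(ℝ, F) ∞ g)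
    (p : M) : ContDiffOn ℝ ∞ (g ∘ (chartAt ℂ p).symm) (chartAt ℂ p).target :=
  have := isManifold_real (M := M)
  (hg.comp_contMDiffOn contMDiffOn_chart_symm).contDiffOn

theorem contMDiff_of_charts [IsManifold 𝓘(ℂ) ω M]
    (hg : ∀ p, ContDiffOn ℝ ∞ (g ∘ (chartAt ℂ p).symm) (chartAt ℂ p).target) :
    ContMDiff 𝓘(ℝ, ℂ) 𝓘(ℝ, F) ∞ g := by
  have := isManifold_real (M := M)
  intro p
  have hsource := (chartAt ℂ p).open_source.mem_nhds (mem_chart_source ℂ p)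
  have hcomp : ContMDiffOn 𝓘(ℝ, ℂ) 𝓘(ℝ, F) ∞ ((g ∘ (chartAt ℂ p).symm) ∘ chartAt ℂ p)
      (chartAt ℂ p).source :=
    (hg p).contMDiffOn.comp contMDiffOn_chart fun _ hq => (chartAt ℂ p).map_source hq
  refine (hcomp.contMDiffAt hsource).congr_of_eventuallyEq ?_
  filter_upwards [hsource] with q hq
  simp only [Function.comp_apply, (chartAt ℂ p).left_inv hq]

theorem diff_eq_fderiv (hg : MDifferentiableAt 𝓘(ℝ, ℂ) 𝓘(ℝ, F) g p) :
    diff g p = fderiv ℝ (g ∘ (chartAt ℂ p).symm) (chartAt ℂ p p) := by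
  rw [diff, hg.mfderiv]
  simp only [writtenInExtChartAt, extChartAt, fderivWithin_univ, mfld_simps]
  rfl

/-- The derivative at `q`, as a complex number, of the coordinate change from the preferred chart
at `q` to the preferred chart at `p`. -/
def transitionDeriv (p q : M) : ℂ :=
  deriv (chartAt ℂ p ∘ (chartAt ℂ q).symm) (chartAt ℂ q q)

theorem differentiableAt_transition [IsManifold 𝓘(ℂ) ω M] {p' : M}
    (hp : q ∈ (chartAt ℂ p).source) (hp' : q ∈ (chartAt ℂ p').source) :
    DifferentiableAt ℂ (chartAt ℂ p' ∘ (chartAt ℂ p).symm) (chartAt ℂ p q) := by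
  have hmem : chartAt ℂ p q ∈ ((chartAt ℂ p).symm ≫ₕ chartAt ℂ p').source := by simp [hp, hp']
  exact ((contDiffOn_transition (chart_mem_atlas ℂ p) (chart_mem_atlas ℂ p')).contDiffAt
    (((chartAt ℂ p).symm ≫ₕ chartAt ℂ p').open_source.mem_nhds hmem)).differentiableAt (by simp)

theorem transitionDeriv_ne_zero [IsManifold 𝓘(ℂ) ω M] (hq : q ∈ (chartAt ℂ p).source) :
    transitionDeriv p q ≠ 0 := fun h0 => by
  have hqq := mem_chart_source ℂ q
  have hderiv : HasDerivAt (chartAt ℂ p ∘ (chartAt ℂ q).symm) 0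
      ((chartAt ℂ q ∘ (chartAt ℂ p).symm) (chartAt ℂ p q)) := by
    rw [Function.comp_apply, (chartAt ℂ p).left_inv hq, ← h0]
    exact (differentiableAt_transition hqq hq).hasDerivAt
  refine not_differentiableAt_of_local_left_inverse_hasDerivAt_zero hderiv ?_
    (differentiableAt_transition hq hqq)
  have hinverse : ∀ᶠ q' in 𝓝 q, (chartAt ℂ q).symm (chartAt ℂ q q') = q' :=
    (chartAt ℂ q).eventually_left_inverse hqq
  filter_upwards [((chartAt ℂ p).eventually_nhds' _ hq).2 hinverse,
    (chartAt ℂ p).open_target.mem_nhds ((chartAt ℂ p).map_source hq)] with z hz hzt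
  simp only [Function.comp_apply, hz, (chartAt ℂ p).right_inv hzt, id]

theorem diff_apply_eq_fderiv [IsManifold 𝓘(ℂ) ω M] (hg : ContMDiff 𝓘(ℝ, ℂ) 𝓘(ℝ, F) ∞ g)
    (hq : q ∈ (chartAt ℂ p).source) (X : ℂ) :
    diff g q X =
      fderiv ℝ (g ∘ (chartAt ℂ p).symm) (chartAt ℂ p q) (transitionDeriv p q * X) := by
  have hqq := mem_chart_source ℂ q
  have hT := differentiableAt_transition hqq hq
  have hTq : (chartAt ℂ p ∘ (chartAt ℂ q).symm) (chartAt ℂ q q) = chartAt ℂ p q := by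
    rw [Function.comp_apply, (chartAt ℂ q).left_inv hqq]
  have hchange : g ∘ (chartAt ℂ q).symm =ᶠ[𝓝 (chartAt ℂ q q)]
      (g ∘ (chartAt ℂ p).symm) ∘ (chartAt ℂ p ∘ (chartAt ℂ q).symm) :=
    ((chartAt ℂ q).eventually_nhds' (fun q' => g q' = g ((chartAt ℂ p).symm (chartAt ℂ p q')))
      hqq).2 (((chartAt ℂ p).eventually_left_inverse hq).mono fun q' hq' => by rw [hq'])
  have hdiff : DifferentiableAt ℝ (g ∘ (chartAt ℂ p).symm)
      ((chartAt ℂ p ∘ (chartAt ℂ q).symm) (chartAt ℂ q q)) := by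
    rw [hTq]
    exact differentiableAt_of_contDiffOn (chartAt ℂ p).open_target
      (contDiffOn_comp_chart_symm hg p) ((chartAt ℂ p).map_source hq)
  rw [diff_eq_fderiv ((hg q).mdifferentiableAt (by simp)), hchange.fderiv_eq,
    fderiv_comp _ hdiff (hT.restrictScalars ℝ), hTq, hT.fderiv_restrictScalars ℝ]
  simp [transitionDeriv, mul_comm]

theorem forall_I_mul_eq_iff {L : ℂ →L[ℝ] F} {A : F →ₗ[ℝ] F} (hA : ∀ v, A (A v) = -v) {c : ℂ}
    (hc : c ≠ 0) : (∀ X, L (c * (I * X)) = A (L (c * X))) ↔ L I = A (L 1) := by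
  refine ⟨fun h => ?_, fun h X => ?_⟩
  · simpa only [mul_left_comm c I, mul_inv_cancel₀ hc, mul_one] using h c⁻¹
  · obtain ⟨Y, rfl⟩ : ∃ Y, X = c⁻¹ * Y := ⟨c * X, by simp [hc]⟩
    have hLY (Z : ℂ) : L Z = Z.re • L 1 + Z.im • L I := by
      rw [← map_smul, ← map_smul, ← map_add]
      simp [re_add_im]
    rw [mul_left_comm I, mul_inv_cancel_left₀ hc, mul_inv_cancel_left₀ hc, hLY, hLY Y, h]
    simp only [map_add, map_smul, hA, mul_re, mul_im, I_re, I_im]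
    module

theorem forall_starDiff_eq_iff [IsManifold 𝓘(ℂ) ω M] (hg : ContMDiff 𝓘(ℝ, ℂ) 𝓘(ℝ, F) ∞ g)
    {A : F →ₗ[ℝ] F} (hA : ∀ v, A (A v) = -v) (hq : q ∈ (chartAt ℂ p).source) :
    (∀ X, starDiff g q X = A (diff g q X)) ↔
      fderiv ℝ (g ∘ (chartAt ℂ p).symm) (chartAt ℂ p q) I =
        A (fderiv ℝ (g ∘ (chartAt ℂ p).symm) (chartAt ℂ p q) 1) := by
  simp only [starDiff, diff_apply_eq_fderiv hg hq]
  exact forall_I_mul_eq_iff hA (transitionDeriv_ne_zero hq)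

end Charts

/-! ### The normal vectors of a conformal immersion -/

section Immersion

variable {M : Type*} [TopologicalSpace M] [ChartedSpace ℂ M] {f K N R : M → ℍ[ℝ]} {p q : M}

/-- The equation `*dK = K dK` at the point `p`: a map `K` into the `2`-sphere of square roots of
`-1` is holomorphic at `p`. -/
def NormalHolomorphicAt (K : M → ℍ[ℝ]) (p : M) : Prop :=
  ∀ X, starDiff K p X = K p * diff K p X

theorem forall_starDiff_eq_mul_iff [IsManifold 𝓘(ℂ) ω M] {a : ℍ[ℝ]}
    (hf : ContMDiff 𝓘(ℝ, ℂ) 𝓘(ℝ, ℍ[ℝ]) ∞ f) (ha : a * a = -1) (hq : q ∈ (chartAt ℂ p).source) :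
    (∀ X, starDiff f q X = a * diff f q X) ↔
      fderiv ℝ (f ∘ (chartAt ℂ p).symm) (chartAt ℂ p q) I =
        a * fderiv ℝ (f ∘ (chartAt ℂ p).symm) (chartAt ℂ p q) 1 :=
  forall_starDiff_eq_iff (A := LinearMap.mulLeft ℝ a) hf
    (fun v => by simp [← mul_assoc, ha]) hq

theorem forall_starDiff_eq_neg_mul_iff [IsManifold 𝓘(ℂ) ω M] {a : ℍ[ℝ]}
    (hf : ContMDiff 𝓘(ℝ, ℂ) 𝓘(ℝ, ℍ[ℝ]) ∞ f) (ha : a * a = -1) (hq : q ∈ (chartAt ℂ p).source) :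
    (∀ X, starDiff f q X = -(diff f q X * a)) ↔
      fderiv ℝ (f ∘ (chartAt ℂ p).symm) (chartAt ℂ p q) I =
        -(fderiv ℝ (f ∘ (chartAt ℂ p).symm) (chartAt ℂ p q) 1 * a) :=
  forall_starDiff_eq_iff (A := -LinearMap.mulRight ℝ a) hf
    (fun v => by simp [mul_assoc, ha]) hq

theorem normalHolomorphicAt_iff [IsManifold 𝓘(ℂ) ω M]
    (hK : ContMDiff 𝓘(ℝ, ℂ) 𝓘(ℝ, ℍ[ℝ]) ∞ K) (hsq : ∀ p, K p * K p = -1)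
    (hq : q ∈ (chartAt ℂ p).source) :
    NormalHolomorphicAt K q ↔ fderiv ℝ (K ∘ (chartAt ℂ p).symm) (chartAt ℂ p q) I =
      K q * fderiv ℝ (K ∘ (chartAt ℂ p).symm) (chartAt ℂ p q) 1 :=
  forall_starDiff_eq_mul_iff hK (hsq q) hq

theorem normalHolomorphicAt_chart_symm_iff [IsManifold 𝓘(ℂ) ω M]
    (hK : ContMDiff 𝓘(ℝ, ℂ) 𝓘(ℝ, ℍ[ℝ]) ∞ K) (hsq : ∀ p, K p * K p = -1) {z : ℂ}
    (hz : z ∈ (chartAt ℂ p).target) :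
    NormalHolomorphicAt K ((chartAt ℂ p).symm z) ↔
      fderiv ℝ (K ∘ (chartAt ℂ p).symm) z I =
        (K ∘ (chartAt ℂ p).symm) z * fderiv ℝ (K ∘ (chartAt ℂ p).symm) z 1 := by
  rw [normalHolomorphicAt_iff hK hsq ((chartAt ℂ p).map_target hz), (chartAt ℂ p).right_inv hz,
    Function.comp_apply]

theorem isClosed_setOf_normalHolomorphicAt [IsManifold 𝓘(ℂ) ω M]
    (hK : ContMDiff 𝓘(ℝ, ℂ) 𝓘(ℝ, ℍ[ℝ]) ∞ K) (hsq : ∀ p, K p * K p = -1) :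
    IsClosed {p | NormalHolomorphicAt K p} := by
  refine isOpen_compl_iff.1 (isOpen_iff_mem_nhds.2 fun p hp => ?_)
  have hps := mem_chart_source ℂ p
  have hpt := mem_chart_target ℂ p
  have hK' := contDiffOn_comp_chart_symm hK p
  have hderiv (X : ℂ) : ContinuousAt (fderiv ℝ (K ∘ (chartAt ℂ p).symm) · X) (chartAt ℂ p p) :=
    (contDiffOn_fderiv_apply (chartAt ℂ p).open_target hK' X).continuousOn.continuousAt
      ((chartAt ℂ p).open_target.mem_nhds hpt)
  have hne : ∀ᶠ z in 𝓝 (chartAt ℂ p p), fderiv ℝ (K ∘ (chartAt ℂ p).symm) z I ≠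
      (K ∘ (chartAt ℂ p).symm) z * fderiv ℝ (K ∘ (chartAt ℂ p).symm) z 1 := by
    refine (hderiv I).ne_iff_eventually_ne ((hK'.continuousOn.continuousAt
      ((chartAt ℂ p).open_target.mem_nhds hpt)).mul (hderiv 1)) |>.1 ?_
    rwa [Ne, Pi.mul_apply, ← normalHolomorphicAt_chart_symm_iff hK hsq hpt,
      (chartAt ℂ p).left_inv hps]
  refine ((chartAt ℂ p).eventually_nhds' (¬NormalHolomorphicAt K ·) hps).1 ?_
  filter_upwards [hne, (chartAt ℂ p).open_target.mem_nhds hpt] with z hz hzt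
  rwa [normalHolomorphicAt_chart_symm_iff hK hsq hzt]

theorem diff_one_ne_zero (hi : Function.Injective (diff f p)) : diff f p 1 ≠ 0 :=
  (map_ne_zero_iff _ hi).2 one_ne_zero

theorem fderiv_comp_chart_symm_one_ne_zero [IsManifold 𝓘(ℂ) ω M]
    (hf : IsConformalImmersion f) {z : ℂ} (hz : z ∈ (chartAt ℂ p).target) :
    fderiv ℝ (f ∘ (chartAt ℂ p).symm) z 1 ≠ 0 := by
  have hq := (chartAt ℂ p).map_target hz
  have hc := transitionDeriv_ne_zero hq
  have h := diff_apply_eq_fderiv hf.smooth hq (transitionDeriv p ((chartAt ℂ p).symm z))⁻¹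
  rw [mul_inv_cancel₀ hc, (chartAt ℂ p).right_inv hz] at h
  rw [← h]
  exact (map_ne_zero_iff _ (hf.immersion _)).2 (inv_ne_zero hc)

theorem contDiffOn_inv {g : ℂ → ℍ[ℝ]} {Ω : Set ℂ} (hg : ContDiffOn ℝ ∞ g Ω)
    (h0 : ∀ z ∈ Ω, g z ≠ 0) : ContDiffOn ℝ ∞ (fun z => (g z)⁻¹) Ω := fun z hz => by
  have hinv := contDiffAt_ringInverse ℝ (n := ∞) (Units.mk0 (g z) (h0 z hz))
  rw [Ring.inverse_eq_inv'] at hinv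
  exact hinv.comp_contDiffWithinAt z (hg z hz)

theorem conformalOn_chart [IsManifold 𝓘(ℂ) ω M] (hf : IsConformalImmersion f)
    (hN : IsLeftNormal f N) (hR : IsRightNormal f R) (p : M) :
    ConformalOn (chartAt ℂ p).target (f ∘ (chartAt ℂ p).symm) (N ∘ (chartAt ℂ p).symm)
      (R ∘ (chartAt ℂ p).symm) := by
  have hopen := (chartAt ℂ p).open_target
  have hF := contDiffOn_comp_chart_symm hf.smooth p
  have hne : ∀ z ∈ (chartAt ℂ p).target, fderiv ℝ (f ∘ (chartAt ℂ p).symm) z 1 ≠ 0 :=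
    fun z hz => fderiv_comp_chart_symm_one_ne_zero hf hz
  have hleft : ∀ z ∈ (chartAt ℂ p).target, fderiv ℝ (f ∘ (chartAt ℂ p).symm) z I =
      N ((chartAt ℂ p).symm z) * fderiv ℝ (f ∘ (chartAt ℂ p).symm) z 1 := fun z hz => by
    simpa only [(chartAt ℂ p).right_inv hz] using (forall_starDiff_eq_mul_iff hf.smooth
      (hN.1 _) ((chartAt ℂ p).map_target hz)).1 (hN.2 _)
  have hright : ∀ z ∈ (chartAt ℂ p).target, fderiv ℝ (f ∘ (chartAt ℂ p).symm) z I =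
      -(fderiv ℝ (f ∘ (chartAt ℂ p).symm) z 1 * R ((chartAt ℂ p).symm z)) := fun z hz => by
    simpa only [(chartAt ℂ p).right_inv hz] using (forall_starDiff_eq_neg_mul_iff hf.smooth
      (hR.1 _) ((chartAt ℂ p).map_target hz)).1 (hR.2 _)
  have hderiv := contDiffOn_fderiv_apply hopen hF
  have hinv := contDiffOn_inv (hderiv 1) hne
  exact {
    isOpen := hopen
    smooth := hF
    smooth_left := ((hderiv I).mul hinv).congr fun z hz => by simp [hleft z hz, hne z hz]
    smooth_right := (hinv.mul (hderiv I)).neg.congr fun z hz => by simp [hright z hz, hne z hz]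
    sq_left := fun z _ => hN.1 _
    sq_right := fun z _ => hR.1 _
    left := hleft
    right := hright
    fderiv_one_ne_zero := hne }

theorem contMDiff_left [IsManifold 𝓘(ℂ) ω M] (hf : IsConformalImmersion f)
    (hN : IsLeftNormal f N) : ContMDiff 𝓘(ℝ, ℂ) 𝓘(ℝ, ℍ[ℝ]) ∞ N := by
  obtain ⟨_, R, -, hR⟩ := hf.conformal
  exact contMDiff_of_charts fun p => (conformalOn_chart hf hN hR p).smooth_left

theorem contMDiff_right [IsManifold 𝓘(ℂ) ω M] (hf : IsConformalImmersion f)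
    (hR : IsRightNormal f R) : ContMDiff 𝓘(ℝ, ℂ) 𝓘(ℝ, ℍ[ℝ]) ∞ R := by
  obtain ⟨N, _, hN, -⟩ := hf.conformal
  exact contMDiff_of_charts fun p => (conformalOn_chart hf hN hR p).smooth_right

theorem IsRightNormal.unique {R' : M → ℍ[ℝ]} (hi : ∀ p, Function.Injective (diff f p))
    (hR : IsRightNormal f R) (hR' : IsRightNormal f R') : R = R' :=
  funext fun p => mul_left_cancel₀ (diff_one_ne_zero (hi p))
    (neg_injective ((hR.2 p 1).symm.trans (hR'.2 p 1)))

theorem rightNormalHolomorphic_iff (hi : ∀ p, Function.Injective (diff f p))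
    (hR : IsRightNormal f R) : RightNormalHolomorphic f ↔ ∀ p, NormalHolomorphicAt R p := by
  refine ⟨?_, fun h => ⟨R, hR, h⟩⟩
  rintro ⟨R', hR', h⟩
  rw [hR.unique hi hR']
  exact h

end Immersion

section Star

variable {M : Type*} [TopologicalSpace M] [ChartedSpace ℂ M] {f N R : M → ℍ[ℝ]}

local instance : StarModule ℝ ℍ[ℝ] := ⟨fun r x => by ext <;> simp⟩

theorem contMDiff_star (hf : ContMDiff 𝓘(ℝ, ℂ) 𝓘(ℝ, ℍ[ℝ]) ∞ f) :
    ContMDiff 𝓘(ℝ, ℂ) 𝓘(ℝ, ℍ[ℝ]) ∞ (fun p => star (f p)) :=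
  (starL' ℝ : ℍ[ℝ] ≃L[ℝ] ℍ[ℝ]).contDiff.contMDiff.comp hf

theorem diff_star (hf : ContMDiff 𝓘(ℝ, ℂ) 𝓘(ℝ, ℍ[ℝ]) ∞ f) (p : M) (X : ℂ) :
    diff (fun p => star (f p)) p X = star (diff f p X) := by
  rw [diff_eq_fderiv ((hf p).mdifferentiableAt (by simp)),
    diff_eq_fderiv ((contMDiff_star hf p).mdifferentiableAt (by simp))]
  exact congrArg (· X) (fderiv_star (𝕜 := ℝ) (f := f ∘ (chartAt ℂ p).symm))

theorem IsLeftNormal.isRightNormal_star (hf : ContMDiff 𝓘(ℝ, ℂ) 𝓘(ℝ, ℍ[ℝ]) ∞ f)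
    (hN : IsLeftNormal f N) : IsRightNormal (fun p => star (f p)) N := by
  refine ⟨hN.1, fun p X => ?_⟩
  rw [starDiff, diff_star hf, diff_star hf, ← starDiff, hN.2, star_mul,
    star_eq_neg_of_mul_self (hN.1 p), mul_neg]

theorem IsRightNormal.isLeftNormal_star (hf : ContMDiff 𝓘(ℝ, ℂ) 𝓘(ℝ, ℍ[ℝ]) ∞ f)
    (hR : IsRightNormal f R) : IsLeftNormal (fun p => star (f p)) R := by
  refine ⟨hR.1, fun p X => ?_⟩
  rw [starDiff, diff_star hf, diff_star hf, ← starDiff, hR.2, star_neg, star_mul,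
    star_eq_neg_of_mul_self (hR.1 p), neg_mul, neg_neg]

theorem IsConformalImmersion.star (hf : IsConformalImmersion f) :
    IsConformalImmersion (fun p => star (f p)) where
  smooth := contMDiff_star hf.smooth
  immersion := fun p X Y h => by
    rw [diff_star hf.smooth, diff_star hf.smooth] at h
    exact hf.immersion p (star_injective h)
  conformal := by
    obtain ⟨N, R, hN, hR⟩ := hf.conformal
    exact ⟨R, N, hR.isLeftNormal_star hf.smooth, hN.isRightNormal_star hf.smooth⟩

end Star

/-! ### Super-conformality and the two normal vectors -/

section SuperConformality

variable {M : Type*} [TopologicalSpace M] [ChartedSpace ℂ M] {f N R : M → ℍ[ℝ]}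

theorem isSuperConformal_iff [IsManifold 𝓘(ℂ) ω M] (hf : IsConformalImmersion f)
    (hN : IsLeftNormal f N) (hR : IsRightNormal f R) :
    IsSuperConformal f ↔ ∀ p, NormalHolomorphicAt N p ∨ NormalHolomorphicAt R p := by
  refine forall_congr' fun p => ?_
  have hp := mem_chart_source ℂ p
  have h := (conformalOn_chart hf hN hR p).curvatureEllipse_eq_circle_iff (mem_chart_target ℂ p)
  rw [normalHolomorphicAt_iff (contMDiff_left hf hN) hN.1 hp,
    normalHolomorphicAt_iff (contMDiff_right hf hR) hR.1 hp]
  simp only [Function.comp_apply, (chartAt ℂ p).left_inv hp] at h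
  rw [← h]
  simp only [curvatureEllipse, secondFundamentalForm, normalSpace,
    diff_eq_fderiv ((hf.smooth p).mdifferentiableAt (by simp))]

theorem forall_or_forall_of_forall_or {X : Type*} [TopologicalSpace X] [PreconnectedSpace X]
    {P Q : X → Prop} (hQ : IsClosed {x | Q x}) (hPQ : ∀ x, P x ∨ Q x)
    (hprop : ∀ x, ∃ V ∈ 𝓝 x, ∀ y ∈ V, (∀ᶠ w in 𝓝 y, P w) → ∀ w ∈ V, P w) :
    (∀ x, P x) ∨ ∀ x, Q x := by
  have hopen : IsOpen {x | ∀ᶠ y in 𝓝 x, P y} := isOpen_setOfPred_eventually_nhds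
  have hclosed : IsClosed {x | ∀ᶠ y in 𝓝 x, P y} := by
    refine isClosed_of_closure_subset fun x hx => ?_
    obtain ⟨V, hV, hVP⟩ := hprop x
    obtain ⟨y, hyV, hy⟩ := mem_closure_iff_nhds.1 hx V hV
    exact Filter.mem_of_superset hV (hVP y hyV hy)
  rcases isClopen_iff.1 ⟨hclosed, hopen⟩ with hempty | huniv
  · refine .inr fun x => hQ.closure_subset (mem_closure_iff_nhds.2 fun V hV => ?_)
    have hx : ¬∀ᶠ y in 𝓝 x, P y := fun h => hempty.le h
    obtain ⟨y, hy, hyV⟩ := ((Filter.not_eventually.1 hx).and_eventually hV).exists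
    exact ⟨y, hyV, (hPQ y).resolve_left hy⟩
  · exact .inl fun x => (huniv.ge (Set.mem_univ x)).self_of_nhds

theorem exists_nhds_forall_normalHolomorphicAt_left [IsManifold 𝓘(ℂ) ω M]
    (hf : IsConformalImmersion f) (hN : IsLeftNormal f N) (hR : IsRightNormal f R)
    (h : ∀ p, NormalHolomorphicAt N p ∨ NormalHolomorphicAt R p) (p : M) :
    ∃ V ∈ 𝓝 p, ∀ q ∈ V, (∀ᶠ w in 𝓝 q, NormalHolomorphicAt N w) →
      ∀ w ∈ V, NormalHolomorphicAt N w := by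
  have hp := mem_chart_source ℂ p
  have hNs := contMDiff_left hf hN
  obtain ⟨ε, hε, hball, hprop⟩ :=
    (conformalOn_chart hf hN hR p).exists_ball_forall_fderiv_left_eq (fun z hz => by
      rw [← normalHolomorphicAt_chart_symm_iff hNs hN.1 hz,
        ← normalHolomorphicAt_chart_symm_iff (contMDiff_right hf hR) hR.1 hz]
      exact (h _).symm) (mem_chart_target ℂ p)
  refine ⟨_, Filter.inter_mem ((chartAt ℂ p).open_source.mem_nhds hp)
    (((chartAt ℂ p).continuousAt hp).preimage_mem_nhds (ball_mem_nhds _ hε)), ?_⟩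
  rintro q ⟨hqs, hqb⟩ hq w ⟨hws, hwb⟩
  refine (normalHolomorphicAt_chart_symm_iff hNs hN.1 (hball hwb)).2
    (hprop _ hqb ?_ _ hwb) |> fun hw => by rwa [(chartAt ℂ p).left_inv hws] at hw
  filter_upwards [((chartAt ℂ p).eventually_nhds' _ hqs).2 hq,
    (chartAt ℂ p).open_target.mem_nhds ((chartAt ℂ p).map_source hqs)] with z hz hzt
  exact (normalHolomorphicAt_chart_symm_iff hNs hN.1 hzt).1 hz

theorem isSuperConformal_iff_rightNormalHolomorphic [PreconnectedSpace M] [IsManifold 𝓘(ℂ) ω M]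
    (hf : IsConformalImmersion f) : IsSuperConformal f ↔
      (RightNormalHolomorphic f ∨ RightNormalHolomorphic (fun p => star (f p))) := by
  obtain ⟨N, R, hN, hR⟩ := hf.conformal
  rw [isSuperConformal_iff hf hN hR, rightNormalHolomorphic_iff hf.immersion hR,
    rightNormalHolomorphic_iff hf.star.immersion (hN.isRightNormal_star hf.smooth), or_comm]
  refine ⟨fun h => ?_, ?_⟩
  · exact forall_or_forall_of_forall_or
      (isClosed_setOf_normalHolomorphicAt (contMDiff_right hf hR) hR.1) h
      (exists_nhds_forall_normalHolomorphicAt_left hf hN hR h)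
  · rintro (h | h) p
    exacts [.inl (h p), .inr (h p)]

end SuperConformality

/-! ### Complex lines in quaternionic lines -/

section Lines

/-- The identification `toH2 : ℂ⁴ → ℍ²` as a continuous real linear equivalence. -/
def toH2L : (Fin 4 → ℂ) ≃L[ℝ] ℍ[ℝ] × ℍ[ℝ] :=
  LinearEquiv.toContinuousLinearEquiv {
    toFun := toH2
    map_add' := fun v w => Prod.ext (by simp [toH2, mul_add, add_add_add_comm])
      (by simp [toH2, mul_add, add_add_add_comm])
    map_smul' := fun r v => (toH2_smul (r : ℂ) v).trans
      (Prod.ext (by simp [Quaternion.mul_coe_eq_smul]) (by simp [Quaternion.mul_coe_eq_smul]))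
    invFun := fun x => ![complexFst x.1, complexSnd x.1, complexFst x.2, complexSnd x.2]
    left_inv := fun v => by
      ext i
      fin_cases i <;> simp [toH2, complexFst_mul, complexSnd_mul, complexFst_coe, complexSnd_coe,
        complexFst_quatJ, complexSnd_quatJ]
    right_inv := fun x => Prod.ext (coe_complexFst_add x.1) (coe_complexFst_add x.2) }

theorem toH2_fst_smul (c : ℂ) (v : Fin 4 → ℂ) : (toH2 (c • v)).1 = (toH2 v).1 * c :=
  congrArg Prod.fst (toH2_smul c v)

theorem toH2_snd_smul (c : ℂ) (v : Fin 4 → ℂ) : (toH2 (c • v)).2 = (toH2 v).2 * c :=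
  congrArg Prod.snd (toH2_smul c v)

theorem mem_affinePoint_submodule_iff {x : ℍ[ℝ]} {v : ℍ[ℝ] × ℍ[ℝ]} :
    v ∈ (affinePoint x).submodule ↔ v.1 = x * v.2 := by
  rw [affinePoint, Projectivization.submodule_mk, Submodule.mem_span_singleton]
  constructor
  · rintro ⟨a, rfl⟩
    simp [MulOpposite.smul_eq_mul_unop]
  · intro h
    exact ⟨MulOpposite.op v.2, Prod.ext (by simp [h]) (by simp)⟩

theorem toH2_fst_eq_mul_snd {M : Type*} {f : M → ℍ[ℝ]} {E : M → CP3} {p : M}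
    (h : IsTwistorProjection E fun p => affinePoint (f p)) {v : Fin 4 → ℂ}
    (hv : v ∈ (E p).submodule) : (toH2 v).1 = f p * (toH2 v).2 := by
  rw [← mem_affinePoint_submodule_iff, h p]
  exact Submodule.subset_span ⟨v, hv, rfl⟩

theorem toH2_snd_ne_zero {x : ℍ[ℝ]} {v : Fin 4 → ℂ} (hv : v ≠ 0)
    (h : (toH2 v).1 = x * (toH2 v).2) : (toH2 v).2 ≠ 0 := fun h0 =>
  hv (toH2L.map_eq_zero_iff.1 (Prod.ext (h.trans (by rw [h0, mul_zero]; rfl)) h0))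

/-- The complex line `L` of `ℂ⁴ = ℍ²` consists of the vectors `(x l, l)` with `K l = -l i`. For
`K² = -1` it lies in the quaternionic line `[x; 1]`, and it is the `-i`-eigenspace of the complex
structure of that quaternionic line given by left multiplication of the coordinate `l` by `K`. -/
def IsNormalLine (x K : ℍ[ℝ]) (L : CP3) : Prop :=
  ∀ v, v ∈ L.submodule ↔
    (toH2 v).1 = x * (toH2 v).2 ∧ K * (toH2 v).2 = -((toH2 v).2 * quatI)

theorem mem_submodule_iff_exists_smul_eq {𝕜 V : Type*} [DivisionRing 𝕜] [AddCommGroup V]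
    [Module 𝕜 V] {L : Projectivization 𝕜 V} {v w : V} (hw : w ∈ L.submodule) (hw0 : w ≠ 0) :
    v ∈ L.submodule ↔ ∃ c : 𝕜, c • w = v := by
  obtain rfl : Projectivization.mk 𝕜 w hw0 = L := by
    induction L using Projectivization.ind with
    | h u hu =>
      rw [Projectivization.submodule_mk, Submodule.mem_span_singleton] at hw
      exact (Projectivization.mk_eq_mk_iff' 𝕜 w u hw0 hu).2 hw
  rw [Projectivization.submodule_mk, Submodule.mem_span_singleton]

theorem isNormalLine_of_mem {x K : ℍ[ℝ]} {L : CP3} {w : Fin 4 → ℂ} (hw : w ∈ L.submodule)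
    (hw0 : w ≠ 0) (hx : (toH2 w).1 = x * (toH2 w).2)
    (hK : K * (toH2 w).2 = -((toH2 w).2 * quatI)) : IsNormalLine x K L := fun v => by
  have hl0 := toH2_snd_ne_zero hw0 hx
  rw [mem_submodule_iff_exists_smul_eq hw hw0, mul_eq_neg_mul_quatI_iff_exists_coe hl0 hK]
  constructor
  · rintro ⟨c, rfl⟩
    exact ⟨by rw [toH2_fst_smul, toH2_snd_smul, hx, mul_assoc], c, toH2_snd_smul c w⟩
  · rintro ⟨hv, c, hc⟩
    refine ⟨c, toH2L.injective (Prod.ext ?_ ?_)⟩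
    · exact (toH2_fst_smul c w).trans (by rw [hx, mul_assoc, ← hc]; exact hv.symm)
    · exact (toH2_snd_smul c w).trans hc.symm

theorem exists_isNormalLine (x : ℍ[ℝ]) {K : ℍ[ℝ]} (hK : K * K = -1) :
    ∃ L, IsNormalLine x K L := by
  obtain ⟨l, hl0, hl⟩ := exists_mul_eq_neg_mul_quatI hK
  have htoH2 : toH2 (toH2L.symm (x * l, l)) = (x * l, l) := toH2L.apply_symm_apply _
  have h0 : toH2L.symm (x * l, l) ≠ 0 := by simp [hl0]
  refine ⟨Projectivization.mk ℂ _ h0, isNormalLine_of_mem ?_ h0 ?_ ?_⟩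
  · rw [Projectivization.submodule_mk]
    exact Submodule.mem_span_singleton_self _
  · rw [htoH2]
  · rwa [htoH2]

theorem IsNormalLine.submodule_affinePoint_eq_span {x K : ℍ[ℝ]} {L : CP3}
    (h : IsNormalLine x K L) : (affinePoint x).submodule =
      Submodule.span (ℍ[ℝ])ᵐᵒᵖ (toH2 '' (L.submodule : Set (Fin 4 → ℂ))) := by
  refine le_antisymm (fun v hv => ?_) (Submodule.span_le.2 ?_)
  · have hrep : L.rep ∈ L.submodule := by
      rw [L.submodule_eq]
      exact Submodule.mem_span_singleton_self _
    have hx := ((h L.rep).1 hrep).1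
    have hv' : v = MulOpposite.op ((toH2 L.rep).2⁻¹ * v.2) • toH2 L.rep := by
      refine Prod.ext ?_ ?_
      · simp [mem_affinePoint_submodule_iff.1 hv, hx, mul_assoc,
          toH2_snd_ne_zero L.rep_nonzero hx]
      · simp [toH2_snd_ne_zero L.rep_nonzero hx]
    rw [hv']
    exact Submodule.smul_mem _ _ (Submodule.subset_span ⟨_, hrep, rfl⟩)
  · rintro _ ⟨v, hv, rfl⟩
    exact mem_affinePoint_submodule_iff.2 ((h v).1 hv).1

end Lines

/-! ### Holomorphic lifts to `ℂP³` -/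

section Sections

variable {V : Type*} [NormedAddCommGroup V] [NormedSpace ℝ V] {φ : V → Fin 4 → ℂ}
  {F K : V → ℍ[ℝ]} {z : V}

theorem toH2_snd_fderiv (hφ : DifferentiableAt ℝ φ z) (X : V) :
    (toH2 (fderiv ℝ φ z X)).2 = fderiv ℝ (fun w => (toH2 (φ w)).2) z X :=
  (fderiv_clm_comp ((ContinuousLinearMap.snd ℝ ℍ[ℝ] ℍ[ℝ]).comp toH2L.toContinuousLinearMap)
    hφ X).symm

theorem differentiableAt_toH2_snd (hφ : DifferentiableAt ℝ φ z) :
    DifferentiableAt ℝ (fun w => (toH2 (φ w)).2) z :=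
  (toH2L.differentiableAt.comp z hφ).snd

theorem toH2_fst_fderiv (hφ : DifferentiableAt ℝ φ z) (hF : DifferentiableAt ℝ F z)
    (hφF : ∀ᶠ w in 𝓝 z, (toH2 (φ w)).1 = F w * (toH2 (φ w)).2) (X : V) :
    (toH2 (fderiv ℝ φ z X)).1 =
      F z * (toH2 (fderiv ℝ φ z X)).2 + fderiv ℝ F z X * (toH2 (φ z)).2 := by
  have hfst : (toH2 (fderiv ℝ φ z X)).1 = fderiv ℝ (fun w => (toH2 (φ w)).1) z X :=
    (fderiv_clm_comp ((ContinuousLinearMap.fst ℝ ℍ[ℝ] ℍ[ℝ]).comp toH2L.toContinuousLinearMap)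
      hφ X).symm
  have hφF' : (fun w => (toH2 (φ w)).1) =ᶠ[𝓝 z] fun w => F w * (toH2 (φ w)).2 := hφF
  rw [hfst, hφF'.fderiv_eq, fderiv_fun_mul' hF (differentiableAt_toH2_snd hφ),
    toH2_snd_fderiv hφ]
  simp

theorem toH2_snd_fderiv_add_I_smul (hφ : DifferentiableAt ℝ φ z) (X Y : V) :
    (toH2 (fderiv ℝ φ z X + I • fderiv ℝ φ z Y)).2 =
      fderiv ℝ (fun w => (toH2 (φ w)).2) z X +
        fderiv ℝ (fun w => (toH2 (φ w)).2) z Y * quatI := by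
  rw [← toH2_snd_fderiv hφ, ← toH2_snd_fderiv hφ, quatI, ← toH2_snd_smul]
  exact congrArg Prod.snd (map_add toH2L _ _)

theorem toH2_fst_fderiv_add_I_smul (hφ : DifferentiableAt ℝ φ z) (hF : DifferentiableAt ℝ F z)
    (hφF : ∀ᶠ w in 𝓝 z, (toH2 (φ w)).1 = F w * (toH2 (φ w)).2) {X Y : V} {a : ℍ[ℝ]}
    (hXY : fderiv ℝ F z Y = -(fderiv ℝ F z X * a)) :
    (toH2 (fderiv ℝ φ z X + I • fderiv ℝ φ z Y)).1 =
      F z * (toH2 (fderiv ℝ φ z X + I • fderiv ℝ φ z Y)).2 +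
        fderiv ℝ F z X * ((toH2 (φ z)).2 - a * (toH2 (φ z)).2 * quatI) := by
  have hadd : toH2 (fderiv ℝ φ z X + I • fderiv ℝ φ z Y) =
      toH2 (fderiv ℝ φ z X) + toH2 (I • fderiv ℝ φ z Y) := map_add toH2L _ _
  rw [hadd, Prod.fst_add, Prod.snd_add, toH2_fst_smul, toH2_snd_smul, ← quatI,
    toH2_fst_fderiv hφ hF hφF, toH2_fst_fderiv hφ hF hφF, hXY]
  noncomm_ring

theorem mul_eq_neg_mul_quatI_iff_sub_eq_zero {a l : ℍ[ℝ]} :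
    a * l = -(l * quatI) ↔ l - a * l * quatI = 0 := by
  rw [← mul_left_inj' quatI_ne_zero, neg_mul, mul_assoc l, quatI_mul_quatI, mul_neg_one, neg_neg,
    sub_eq_zero, eq_comm]

end Sections

section Lifts

variable {M : Type*} [TopologicalSpace M] [ChartedSpace ℂ M] {f R : M → ℍ[ℝ]} {E : M → CP3}
  {φ : M → Fin 4 → ℂ} {p : M}

theorem differentiableAt_comp_chart_symm {F : Type*} [NormedAddCommGroup F] [NormedSpace ℝ F]
    {g : M → F} (hg : MDifferentiableAt 𝓘(ℝ, ℂ) 𝓘(ℝ, F) g p) :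
    DifferentiableAt ℝ (g ∘ (chartAt ℂ p).symm) (chartAt ℂ p p) := by
  have h := hg.differentiableWithinAt_writtenInExtChartAt
  simp only [writtenInExtChartAt, extChartAt, mfld_simps, differentiableWithinAt_univ] at h
  exact h

theorem delta_I_mul_eq_iff (hφ : MDifferentiableAt 𝓘(ℝ, ℂ) 𝓘(ℝ, Fin 4 → ℂ) φ p) (X : ℂ) :
    delta E φ p (I * X) = delta E (fun q => I • φ q) p X ↔
      diff φ p X + I • diff φ p (I * X) ∈ (E p).submodule := by
  let smulI : (Fin 4 → ℂ) →L[ℝ] Fin 4 → ℂ :=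
    (I • ContinuousLinearMap.id ℂ (Fin 4 → ℂ)).restrictScalars ℝ
  have hdiff : diff (fun q => I • φ q) p X = I • diff φ p X := by
    have hsmulI : MDifferentiableAt 𝓘(ℝ, ℂ) 𝓘(ℝ, Fin 4 → ℂ) (fun q => I • φ q) p :=
      smulI.differentiableAt.mdifferentiableAt.comp p hφ
    rw [diff_eq_fderiv hφ, diff_eq_fderiv hsmulI]
    exact fderiv_clm_comp smulI (differentiableAt_comp_chart_symm hφ) X
  rw [delta, delta, hdiff, Submodule.mkQ_apply, Submodule.mkQ_apply, Submodule.Quotient.eq,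
    ← (E p).submodule.smul_mem_iff I_ne_zero, smul_sub, smul_smul, I_mul_I, neg_one_smul,
    sub_neg_eq_add, add_comm]

theorem IsSection.mdifferentiableAt {U : Set M} (hφ : IsSection E U φ) (hU : IsOpen U)
    (hp : p ∈ U) : MDifferentiableAt 𝓘(ℝ, ℂ) 𝓘(ℝ, Fin 4 → ℂ) φ p :=
  (hφ.1.contMDiffAt (hU.mem_nhds hp)).mdifferentiableAt (by simp)

theorem toH2_fst_diff_add_I_smul (hf : ContMDiff 𝓘(ℝ, ℂ) 𝓘(ℝ, ℍ[ℝ]) ∞ f) {U : Set M}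
    (hU : IsOpen U) (hp : p ∈ U) (hR : IsRightNormal f R) (hφ : IsSection E U φ)
    (hφf : ∀ q ∈ U, (toH2 (φ q)).1 = f q * (toH2 (φ q)).2) (X : ℂ) :
    (toH2 (diff φ p X + I • diff φ p (I * X))).1 =
      f p * (toH2 (diff φ p X + I • diff φ p (I * X))).2 +
        diff f p X * ((toH2 (φ p)).2 - R p * (toH2 (φ p)).2 * quatI) := by
  have hps := mem_chart_source ℂ p
  have hφd := hφ.mdifferentiableAt hU hp
  have hfd := (hf p).mdifferentiableAt (by simp)
  have hXY := hR.2 p X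
  rw [starDiff, diff_eq_fderiv hfd] at hXY
  have h := toH2_fst_fderiv_add_I_smul (differentiableAt_comp_chart_symm hφd)
    (differentiableAt_comp_chart_symm hfd)
    (((chartAt ℂ p).eventually_nhds' (fun q => (toH2 (φ q)).1 = f q * (toH2 (φ q)).2) hps).2
      (Filter.mem_of_superset (hU.mem_nhds hp) hφf)) hXY
  simpa only [diff_eq_fderiv hφd, diff_eq_fderiv hfd, Function.comp_apply,
    (chartAt ℂ p).left_inv hps] using h

theorem normal_defect_mul_toH2_snd (hRs : ContMDiff 𝓘(ℝ, ℂ) 𝓘(ℝ, ℍ[ℝ]) ∞ R)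
    (hsq : ∀ p, R p * R p = -1) {U : Set M} (hU : IsOpen U) (hp : p ∈ U)
    (hφ : IsSection E U φ) (hφR : ∀ q ∈ U, R q * (toH2 (φ q)).2 = -((toH2 (φ q)).2 * quatI))
    (X : ℂ) :
    (starDiff R p X - R p * diff R p X) * (toH2 (φ p)).2 * quatI =
      -(R p * (toH2 (diff φ p X + I • diff φ p (I * X))).2 +
        (toH2 (diff φ p X + I • diff φ p (I * X))).2 * quatI) := by
  have hps := mem_chart_source ℂ p
  have hφd := hφ.mdifferentiableAt hU hp
  have hRd := (hRs p).mdifferentiableAt (by simp)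
  have hφd' := differentiableAt_comp_chart_symm hφd
  have h := sub_mul_fderiv_mul_eq (differentiableAt_comp_chart_symm hRd)
    (differentiableAt_toH2_snd hφd') (.of_forall fun z => hsq _)
    (((chartAt ℂ p).eventually_nhds'
      (fun q => R q * (toH2 (φ q)).2 = -((toH2 (φ q)).2 * quatI)) hps).2
      (Filter.mem_of_superset (hU.mem_nhds hp) hφR)) X (I * X)
  rw [← toH2_snd_fderiv_add_I_smul hφd'] at h
  simpa only [starDiff, diff_eq_fderiv hφd, diff_eq_fderiv hRd, Function.comp_apply,
    (chartAt ℂ p).left_inv hps] using h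

theorem delta_I_mul_eq_iff_of_isNormalLine (hf : ContMDiff 𝓘(ℝ, ℂ) 𝓘(ℝ, ℍ[ℝ]) ∞ f)
    (hR : IsRightNormal f R) (hRs : ContMDiff 𝓘(ℝ, ℂ) 𝓘(ℝ, ℍ[ℝ]) ∞ R)
    (hE : ∀ p, IsNormalLine (f p) (R p) (E p)) {U : Set M} (hU : IsOpen U) (hp : p ∈ U)
    (hφ : IsSection E U φ) (X : ℂ) :
    delta E φ p (I * X) = delta E (fun q => I • φ q) p X ↔
      (starDiff R p X - R p * diff R p X) * (toH2 (φ p)).2 = 0 := by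
  have hφE : ∀ q ∈ U, _ := fun q hq => (hE q _).1 (hφ.2 q hq)
  have hfst := toH2_fst_diff_add_I_smul hf hU hp hR hφ (fun q hq => (hφE q hq).1) X
  rw [mul_eq_neg_mul_quatI_iff_sub_eq_zero.1 (hφE p hp).2, mul_zero, add_zero] at hfst
  rw [delta_I_mul_eq_iff (hφ.mdifferentiableAt hU hp), hE p, and_iff_right hfst,
    eq_neg_iff_add_eq_zero, ← neg_eq_zero,
    ← normal_defect_mul_toH2_snd hRs hR.1 hU hp hφ (fun q hq => (hφE q hq).2),
    mul_eq_zero, or_iff_left quatI_ne_zero]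

theorem isNormalLine_of_isTwistorProjection (hf : IsConformalImmersion f)
    (hR : IsRightNormal f R) (hE : IsHolomorphicCurve E)
    (hproj : IsTwistorProjection E fun p => affinePoint (f p)) (p : M) :
    IsNormalLine (f p) (R p) (E p) := by
  obtain ⟨U, hU, hp, φ, hφ, hφ0⟩ := hE.1 p
  have hφf : ∀ q ∈ U, (toH2 (φ q)).1 = f q * (toH2 (φ q)).2 := fun q hq =>
    toH2_fst_eq_mul_snd hproj (hφ.2 q hq)
  have hmem := (delta_I_mul_eq_iff (hφ.mdifferentiableAt hU hp) 1).1 (hE.2 U φ hU hφ p hp 1)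
  have hfst := toH2_fst_diff_add_I_smul hf.smooth hU hp hR hφ hφf 1
  rw [toH2_fst_eq_mul_snd hproj hmem, left_eq_add, mul_eq_zero,
    or_iff_right (diff_one_ne_zero (hf.immersion p)), ← mul_eq_neg_mul_quatI_iff_sub_eq_zero]
    at hfst
  exact isNormalLine_of_mem (hφ.2 p hp) (hφ0 p hp) (hφf p hp) hfst

theorem mul_one_sub_mul {A : Type*} [Ring A] {a b : A} (ha : a * a = -1) (hb : b * b = -1) :
    a * (1 - a * b) = (1 - a * b) * b := by
  rw [mul_sub, sub_mul, ← mul_assoc, ha, mul_assoc, hb]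
  noncomm_ring

theorem isLineSubbundle_of_isNormalLine (hf : ContMDiff 𝓘(ℝ, ℂ) 𝓘(ℝ, ℍ[ℝ]) ∞ f)
    (hRs : ContMDiff 𝓘(ℝ, ℂ) 𝓘(ℝ, ℍ[ℝ]) ∞ R) (hsq : ∀ p, R p * R p = -1)
    (hE : ∀ p, IsNormalLine (f p) (R p) (E p)) : IsLineSubbundle E := fun p => by
  obtain ⟨l₀, hl₀, hl₀R⟩ := exists_mul_eq_neg_mul_quatI (hsq p)
  let l : ℍ[ℝ] → ℍ[ℝ] := fun K => (1 - K * R p) * l₀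
  have hl : ContDiff ℝ ∞ l := by fun_prop
  have hlR (q : M) : R q * l (R q) = -(l (R q) * quatI) := by
    rw [← mul_assoc, mul_one_sub_mul (hsq q) (hsq p), mul_assoc, hl₀R, mul_neg, ← mul_assoc]
  have htoH2 (q : M) :
      toH2 (toH2L.symm (f q * l (R q), l (R q))) = (f q * l (R q), l (R q)) :=
    toH2L.apply_symm_apply _
  have hφ : ContDiff ℝ ∞ fun x : ℍ[ℝ] × ℍ[ℝ] => toH2L.symm (x.1 * l x.2, l x.2) := by
    fun_prop
  refine ⟨{q | l (R q) ≠ 0}, isOpen_ne_fun (hl.continuous.comp hRs.continuous) continuous_const,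
    ?_, fun q => toH2L.symm (f q * l (R q), l (R q)),
    ⟨(hφ.contMDiff.comp (hf.prodMk_space hRs)).contMDiffOn, fun q _ => ?_⟩, fun q hq => ?_⟩
  · have h2 : (1 - R p * R p) * l₀ = (2 : ℝ) • l₀ := by
      rw [hsq, sub_neg_eq_add, one_add_one_eq_two, two_mul, two_smul]
    exact h2.trans_ne (smul_ne_zero two_ne_zero hl₀)
  · rw [hE, htoH2]
    exact ⟨rfl, hlR q⟩
  · exact toH2L.symm.map_eq_zero_iff.not.2 fun h => hq (congrArg Prod.snd h)

theorem isTwistorHolomorphic_iff [IsManifold 𝓘(ℂ) ω M] (hf : IsConformalImmersion f) :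
    IsTwistorHolomorphic (fun p => affinePoint (f p)) ↔ RightNormalHolomorphic f := by
  obtain ⟨_, R, -, hR⟩ := hf.conformal
  have hRs := contMDiff_right hf hR
  rw [rightNormalHolomorphic_iff hf.immersion hR]
  refine ⟨fun ⟨E, hE, hproj⟩ p X => ?_, fun h => ?_⟩
  · have hnormal := isNormalLine_of_isTwistorProjection hf hR hE hproj
    obtain ⟨U, hU, hp, φ, hφ, hφ0⟩ := hE.1 p
    have hzero := (delta_I_mul_eq_iff_of_isNormalLine hf.smooth hR hRs hnormal hU hp hφ X).1
      (hE.2 U φ hU hφ p hp X)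
    have hl0 := toH2_snd_ne_zero (hφ0 p hp) (toH2_fst_eq_mul_snd hproj (hφ.2 p hp))
    exact sub_eq_zero.1 ((mul_eq_zero.1 hzero).resolve_right hl0)
  · choose E hE using fun p => exists_isNormalLine (f p) (hR.1 p)
    refine ⟨E, ⟨isLineSubbundle_of_isNormalLine hf.smooth hRs hR.1 hE, ?_⟩,
      fun p => (hE p).submodule_affinePoint_eq_span⟩
    intro U φ hU hφ p hp X
    rw [delta_I_mul_eq_iff_of_isNormalLine hf.smooth hR hRs hE hU hp hφ, sub_eq_zero.2 (h p X),
      zero_mul]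

end Lifts

end

end SuperConformal

theorem mainTheorem4_general {M : Type*} [TopologicalSpace M] [PreconnectedSpace M]
    [ChartedSpace ℂ M] [IsManifold 𝓘(ℂ) ω M]
    (f : M → ℍ[ℝ]) (hf : SuperConformal.IsConformalImmersion f) :
    (SuperConformal.IsSuperConformal f ↔
      (SuperConformal.IsTwistorHolomorphic (fun p => SuperConformal.affinePoint (f p)) ∨
        SuperConformal.IsTwistorHolomorphic (fun p => SuperConformal.affinePoint (star (f p))))) ∧
    (SuperConformal.IsSuperConformal f ↔
      (SuperConformal.RightNormalHolomorphic f ∨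
        SuperConformal.RightNormalHolomorphic (fun p => star (f p)))) := by
  have h := SuperConformal.isSuperConformal_iff_rightNormalHolomorphic hf
  refine ⟨?_, h⟩
  rw [h, SuperConformal.isTwistorHolomorphic_iff hf,
    SuperConformal.isTwistorHolomorphic_iff hf.star]

theorem mainTheorem4 {M : Type*} [TopologicalSpace M] [T2Space M] [ConnectedSpace M]
    [ChartedSpace ℂ M] [IsManifold 𝓘(ℂ) ω M]
    (f : M → ℍ[ℝ]) (hf : SuperConformal.IsConformalImmersion f) :
    (SuperConformal.IsSuperConformal f ↔
      (SuperConformal.IsTwistorHolomorphic (fun p => SuperConformal.affinePoint (f p)) ∨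
        SuperConformal.IsTwistorHolomorphic (fun p => SuperConformal.affinePoint (star (f p))))) ∧
    (SuperConformal.IsSuperConformal f ↔
      (SuperConformal.RightNormalHolomorphic f ∨
        SuperConformal.RightNormalHolomorphic (fun p => star (f p)))) :=
  mainTheorem4_general f hf
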